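/- **Theorem 1.3.** Let $d\in\{2,3\}$, $T>0$, $\mathbb T^d=(\mathbb R/\mathbb Z)^d$, and let $m\in\{d,3\}$ be the number of components of vector fields on $\mathbb T^d$. Such fields are treated as three-dimensional fields: for $d=2$ nothing depends on $x_3$ (so $\partial_3=0$), for $m=2$ the third component vanishes, and $\nabla$, $\mathrm{div}$, $\nabla\times$ are the usual three-dimensional operators. Let $u,h\in C([0,T];L^2(\mathbb T^d;\mathbb R^m))$ be such that $(u,h)$ is a weak solution of the inviscid Hall-MHD equations $$u_t+u\cdot\nabla u-h\cdot\nabla h+\nabla\Pi=0,\qquad h_t+u\cdot\nabla h-h\cdot\nabla u+\nabla\times[(\nabla\times h)\times h]=0,\qquad \mathrm{div}\,u=\mathrm{div}\,h=0,$$ that is: $\int_0^T\!\int_{\mathbb T^d}u\cdot\nabla\psi\,dx\,dt=\int_0^T\!\int_{\mathbb T^d}h\cdot\nabla\psi\,dx\,dt=0$ for all $\psi\in C^\infty([0,T]\times\mathbb T^d)$, and for every divergence-free vector field $\varphi\in C_0^\infty((0,T)\times\mathbb T^d;\mathbb R^m)$ $$\int_0^T\!\!\int_{\mathbb T^d}\partial_t\varphi\cdot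 u+\nabla\varphi:(u\otimes u-h\otimes h)\,dx\,dt=0,$$ $$\int_0^T\!\!\int_{\mathbb T^d}\partial_t\varphi\cdot h+\nabla\varphi:(h\otimes u-u\otimes h)+(h\otimes h):\nabla(\nabla\times\varphi)\,dx\,dt=0,$$ where $(\nabla\varphi)_{ij}=\partial_j\varphi_i$, $(a\otimes b)_{ij}=a_ib_j$ and $A:B=\sum_{i,j}A_{ij}B_{ij}$. For $\alpha\in(0,1)$ write $f\in L^3(0,T;\underline B^{\alpha}_{3,VMO}(\mathbb T^d))$ if $\|f\|_{L^3(0,T;L^3(\mathbb T^d))}<\infty$ and $$\lim_{\varepsilon\to0^+}\frac1{\varepsilon^{\alpha}}\left(\int_0^T\int_{\mathbb T^d}\frac1{|B_\varepsilon(0)|}\int_{B_\varepsilon(0)}|f(t,x)-f(t,x-y)|^3\,dy\,dx\,dt\right)^{1/3}=0 .$$ If $u\in L^3(0,T;\underline B^{1/3}_{3,VMO}(\mathbb T^d))$ and $h\in L^3(0,T;\underline B^{2/3}_{3,VMO}(\mathbb T^d))$, then the total energy is conserved: for every $t\in[0,T]$, $$\frac12\int_{\mathbb T^d}\big(|u(t,x)|^2+|h(t,x)|^2\big)\,dx=\frac12\int_{\mathbb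 T^d}\big(|u(0,x)|^2+|h(0,x)|^2\big)\,dx .$$ -/

import Mathlib

open MeasureTheory Set Filter Topology
open scoped ContDiff

noncomputable section

namespace HallMHD

/-- The flat torus `𝕋^d = (ℝ/ℤ)^d`, with its normalized Lebesgue (Haar) measure. -/
abbrev Torus (d : ℕ) : Type := UnitAddTorus (Fin d)

/-- `ℝ^m` with the Euclidean norm. -/
abbrev Vec (m : ℕ) : Type := EuclideanSpace ℝ (Fin m)

/-- `L²(𝕋^d; ℝ^m)`. -/
abbrev L2 (d m : ℕ) : Type := Lp (Vec m) 2 (volume : Measure (Torus d))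

/-- The quotient map `ℝ^d → 𝕋^d`. -/
def toTorus {d : ℕ} (y : Vec d) : Torus d := fun i => (y i : UnitAddCircle)

/-! ### Vector calculus

A field on `𝕋^d` with values in `ℝ^m` (`d, m ≤ 3`) is treated as a three-dimensional field: it does
not depend on the coordinates `x_j`, `d ≤ j < 3`, and its components of index `≥ m` vanish. All
differential operators are then the usual three-dimensional ones. Indices run through `Fin 3`. -/

/-- The `i`-th component of `v ∈ ℝ^m ⊆ ℝ³`. -/
def comp {m : ℕ} (v : Vec m) (i : Fin 3) : ℝ :=
  if hi : i.1 < m then v ⟨i.1, hi⟩ else 0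

/-- The partial derivative `∂_j g` of a function on `𝕋^d`, which is `0` for `j ≥ d`. -/
def pderiv {d : ℕ} (j : Fin 3) (g : Torus d → ℝ) (x : Torus d) : ℝ :=
  if hj : j.1 < d then
    deriv (fun s : ℝ => g (x + toTorus (s • EuclideanSpace.single (⟨j.1, hj⟩ : Fin d) (1 : ℝ)))) 0
  else 0

/-- `div φ = ∑_i ∂_i φ_i`. -/
def divergence {d m : ℕ} (φ : Torus d → Vec m) (x : Torus d) : ℝ :=
  ∑ i : Fin 3, pderiv i (fun z => comp (φ z) i) x

/-- `(∇ × φ)_i = ∂_{i+1} φ_{i+2} - ∂_{i+2} φ_{i+1}`, indices modulo `3`. -/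
def curl {d m : ℕ} (φ : Torus d → Vec m) (i : Fin 3) (x : Torus d) : ℝ :=
  pderiv (i + 1) (fun z => comp (φ z) (i + 2)) x
    - pderiv (i + 2) (fun z => comp (φ z) (i + 1)) x

/-! ### Weak solutions -/

/-- Smoothness of a time-dependent function on the torus: its periodic lift to `ℝ × ℝ^d` is
`C^∞`. -/
def IsSmooth {d : ℕ} {F : Type*} [NormedAddCommGroup F] [NormedSpace ℝ F]
    (φ : ℝ → Torus d → F) : Prop :=
  ContDiff ℝ ∞ (fun p : ℝ × Vec d => φ p.1 (toTorus p.2))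

/-- Divergence-free vector fields in `C_0^∞((0,T) × 𝕋^d)`. -/
structure IsTestField {d m : ℕ} (T : ℝ) (φ : ℝ → Torus d → Vec m) : Prop where
  smooth : IsSmooth φ
  compact : HasCompactSupport (fun p : ℝ × Torus d => φ p.1 p.2)
  support : tsupport (fun p : ℝ × Torus d => φ p.1 p.2) ⊆ Ioo 0 T ×ˢ univ
  div_free : ∀ t x, divergence (φ t) x = 0

/-- `v` is divergence-free on `[0,T] × 𝕋^d` in the sense of distributions:
`∫_0^T ∫ v · ∇ψ dx dt = 0` for all scalar `ψ ∈ C^∞([0,T] × 𝕋^d)`. -/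
def IsDivFree {d m : ℕ} (T : ℝ) (v : ℝ → L2 d m) : Prop :=
  ∀ ψ : ℝ → Torus d → ℝ, IsSmooth ψ →
    ∫ t in (0 : ℝ)..T, ∫ x : Torus d, ∑ j : Fin 3, comp (v t x) j * pderiv j (ψ t) x = 0

/-- `v ∈ C_weak([0,T]; L²)`. -/
def WeaklyContinuous {d m : ℕ} (T : ℝ) (v : ℝ → L2 d m) : Prop :=
  ∀ w : L2 d m, ContinuousOn (fun t => inner ℝ (v t) w) (Icc 0 T)

/-- Weak solutions `(u,h)` on `[0,T] × 𝕋^d` of the inviscid incompressible Hall-MHD equations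
`u_t + u·∇u - h·∇h + ∇Π = 0`, `h_t + u·∇h - h·∇u + ∇×[(∇×h)×h] = 0`, `div u = div h = 0`.
Here `(∇φ)_{ij} = ∂_j φ_i`, `(a ⊗ b)_{ij} = a_i b_j` and `A : B = ∑_{ij} A_{ij} B_{ij}`; for
divergence-free `h` one has `∇×[(∇×h)×h] = ∇×[div(h ⊗ h)]`. -/
structure IsWeakSolution {d m : ℕ} (T : ℝ) (u h : ℝ → L2 d m) : Prop where
  weaklyContinuous_u : WeaklyContinuous T u
  weaklyContinuous_h : WeaklyContinuous T h
  divFree_u : IsDivFree T u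
  divFree_h : IsDivFree T h
  /-- `∫∫ ∂_t φ · u + ∇φ : (u ⊗ u - h ⊗ h) = 0`. -/
  momentum : ∀ φ : ℝ → Torus d → Vec m, IsTestField T φ →
    ∫ t in (0 : ℝ)..T, ∫ x : Torus d,
      ((∑ i : Fin 3, deriv (fun s => comp (φ s x) i) t * comp (u t x) i)
        + ∑ i : Fin 3, ∑ j : Fin 3, pderiv j (fun z => comp (φ t z) i) x *
            (comp (u t x) i * comp (u t x) j - comp (h t x) i * comp (h t x) j)) = 0
  /-- `∫∫ ∂_t φ · h + ∇φ : (h ⊗ u - u ⊗ h) + (h ⊗ h) : ∇(∇ × φ) = 0`. -/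
  induction : ∀ φ : ℝ → Torus d → Vec m, IsTestField T φ →
    ∫ t in (0 : ℝ)..T, ∫ x : Torus d,
      ((∑ i : Fin 3, deriv (fun s => comp (φ s x) i) t * comp (h t x) i)
        + (∑ i : Fin 3, ∑ j : Fin 3, pderiv j (fun z => comp (φ t z) i) x *
            (comp (h t x) i * comp (u t x) j - comp (u t x) i * comp (h t x) j))
        + ∑ i : Fin 3, ∑ j : Fin 3, comp (h t x) i * comp (h t x) j *
            pderiv j (curl (φ t) i) x) = 0

/-! ### The Besov-VMO space -/

/-- `f ∈ L^p(0,T; B^α_{q,VMO}(𝕋^d))` (finite `p, q`), for a time-dependent `L²` field `f`: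
`f` is measurable in time, `‖f‖_{L^p(0,T;L^q)} < ∞`, and
`ε^{-α} (∫_0^T [∫_{𝕋^d} ⨍_{B_ε(0)} |f(t,x) - f(t,x-y)|^q dy dx]^{p/q} dt)^{1/p} → 0`
as `ε → 0+`. -/
structure MemBesovVMO {d m : ℕ} (T p q α : ℝ) (f : ℝ → L2 d m) : Prop where
  measurable : AEStronglyMeasurable f (volume.restrict (Ioo 0 T))
  norm_lt_top :
    (∫⁻ t in Ioo 0 T, (∫⁻ x : Torus d, ‖f t x‖ₑ ^ q) ^ (p / q)) ^ (1 / p) < ⊤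
  vmo : Tendsto (fun ε : ℝ => ENNReal.ofReal (ε ^ (-α)) *
      (∫⁻ t in Ioo 0 T, (∫⁻ x : Torus d, ⨍⁻ y in Metric.ball (0 : Vec d) ε,
        ‖f t x - f t (x - toTorus y)‖ₑ ^ q ∂volume) ^ (p / q)) ^ (1 / p))
    (𝓝[>] 0) (𝓝 0)

/-- The total energy `½ ∫_{𝕋^d} (|u|² + |h|²) dx`. -/
def energy {d m : ℕ} (u h : L2 d m) : ℝ :=
  (1 / 2) * ∫ x : Torus d, (‖u x‖ ^ 2 + ‖h x‖ ^ 2)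

end HallMHD

end

noncomputable section

namespace HallMHD

variable {d m : ℕ}

/-! ### The quotient map and smooth functions on the torus -/

/-! The proof is a Constantin–E–Titi argument. Fix an even mollifier `ρ`, let `ρ_ε = scaled ε ρ`,
and follow the energy of the mollified fields `ρ_ε * u`, `ρ_ε * h`. Its rate of change is an energy
flux, the flux is cubic in increments at scale `ε`, and the two VMO conditions are exactly what
makes its time integral vanish as `ε → 0`.

Balance. No time derivative of `u` or `h` is available, so the solution is not inserted as its own
test field. For a frozen time `a`, the field `ρ_ε * ρ_ε * u(a)` times a scalar function of time is
an admissible test field, and it shows that `b ↦ ∫ (ρ_ε * u(a)) · (ρ_ε * u(b))` is a primitive of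
the momentum form; `h` is treated in the same way. These pairings are symmetric in `a` and `b`
because `ρ` is even, so the diagonal is differentiable with twice the partial derivative
(`diag_sub_eq_integral`). This gives `IsWeakSolution.mollified_energy_sub`, with the flux on the
right.

Cancellation. If every mollified product in the flux were the product of the mollifications, the
integrand would be the divergence of `fluxField` and integrate to zero (`sum_pderiv_fluxField`).
Only commutators `(fg)_ε - f_ε g_ε` survive (`flux_eq_commut`).

Estimate. Since `ρ_ε` has integral one, a commutator is quadratic in increments (`commut_eq`). A
derivative falling on the kernel yields a mean-zero kernel, hence one more increment, at the price
of a factor `ε⁻¹`. The convective terms carry one derivative and the Hall term two, so by Hölder on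
the ball the flux is at most a constant times `ε⁻¹ (incr u + incr h) + ε⁻² incr h`
(`enorm_flux_le`). The conditions with exponents 1/3 and 2/3, once cubed, say that `ε⁻¹ ∫ incr u`
and `ε⁻² ∫ incr h` tend to zero.

Limit. At every single time the mollified energy tends to the true one (`tendsto_pairing`), so the
energies at times `0` and `t` agree. Measurability of the increments in time comes from their lower
semicontinuity on `L²` (`lowerSemicontinuous_incr`). -/

theorem toTorus_add (x y : Vec d) : toTorus (x + y) = toTorus x + toTorus y := by
  funext i; simp [toTorus]

theorem toTorus_sub (x y : Vec d) : toTorus (x - y) = toTorus x - toTorus y := by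
  funext i; simp [toTorus]

theorem toTorus_neg (x : Vec d) : toTorus (-x) = - toTorus x := by
  funext i; simp [toTorus]

theorem toTorus_zero : toTorus (0 : Vec d) = 0 := by
  funext i; simp [toTorus]

theorem isOpenQuotientMap_toTorus : IsOpenQuotientMap (toTorus : Vec d → Torus d) := by
  have h1 : IsOpenQuotientMap (Pi.map (fun (_ : Fin d) (r : ℝ) => (r : UnitAddCircle))) :=
    IsOpenQuotientMap.piMap fun _ => QuotientAddGroup.isOpenQuotientMap_mk
  exact h1.comp (EuclideanSpace.equiv (Fin d) ℝ).toHomeomorph.isOpenQuotientMap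

theorem continuous_toTorus : Continuous (toTorus : Vec d → Torus d) :=
  isOpenQuotientMap_toTorus.continuous

theorem measurable_toTorus : Measurable (toTorus : Vec d → Torus d) :=
  continuous_toTorus.measurable

theorem surjective_toTorus : Function.Surjective (toTorus : Vec d → Torus d) :=
  isOpenQuotientMap_toTorus.surjective

instance : IsProbabilityMeasure (volume : Measure UnitAddCircle) := ⟨UnitAddCircle.measure_univ⟩

instance : IsProbabilityMeasure (volume : Measure (Torus d)) :=
  inferInstanceAs (IsProbabilityMeasure (Measure.pi fun _ : Fin d => (volume : Measure UnitAddCircle)))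

instance : (volume : Measure (Torus d)).IsAddHaarMeasure :=
  inferInstanceAs ((Measure.pi fun _ : Fin d => (volume : Measure UnitAddCircle)).IsAddHaarMeasure)

instance : (volume : Measure (Torus d)).IsNegInvariant :=
  Measure.IsAddHaarMeasure.isNegInvariant_of_regular _

instance : (volume : Measure (Torus d)).IsOpenPosMeasure :=
  inferInstanceAs ((Measure.pi fun _ : Fin d => (volume : Measure UnitAddCircle)).IsOpenPosMeasure)

/-- The fundamental cube `(-1/2, 1/2]^d`. -/
def cube (d : ℕ) : Set (Vec d) := {y | ∀ i, y i ∈ Ioc (-(1 / 2) : ℝ) (-(1 / 2) + 1)}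

/-- The product of the corresponding statements for the circle. The cube is centred at the origin so
that it contains the ball of radius 1/2: a kernel supported there meets each point of the torus at
most once. -/
theorem measurePreserving_toTorus :
    MeasurePreserving (toTorus : Vec d → Torus d) (volume.restrict (cube d)) volume := by
  have h0 := (PiLp.volume_preserving_ofLp (Fin d)).restrict_preimage
    (s := Set.pi univ fun _ : Fin d => Ioc (-(1 / 2) : ℝ) (-(1 / 2) + 1))
    (MeasurableSet.univ_pi fun i => measurableSet_Ioc)
  have h1 := measurePreserving_pi (fun _ : Fin d => volume.restrict (Ioc (-(1 / 2) : ℝ) (-(1 / 2) + 1)))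
    (fun _ => (volume : Measure UnitAddCircle)) fun _ => UnitAddCircle.measurePreserving_mk (-(1 / 2))
  rw [← Measure.restrict_pi_pi] at h1
  have h2 : cube d = WithLp.ofLp ⁻¹'
      Set.pi univ fun _ : Fin d => Ioc (-(1 / 2) : ℝ) (-(1 / 2) + 1) := by
    ext; simp [cube]
  rw [h2]
  exact h1.comp h0

theorem ball_subset_cube : Metric.ball (0 : Vec d) (1 / 2) ⊆ cube d := by
  intro y hy i
  have h1 : ‖y i‖ ≤ ‖y‖ := PiLp.norm_apply_le y i
  rw [mem_ball_zero_iff] at hy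
  have := abs_lt.1 (lt_of_le_of_lt h1 hy : |y i| < 1 / 2)
  constructor <;> linarith [this.1, this.2]

/-- Smoothness of a function on the torus. -/
def Sm (g : Torus d → ℝ) : Prop := ContDiff ℝ ∞ fun X : Vec d => g (toTorus X)

theorem Sm.continuous {g : Torus d → ℝ} (hg : Sm g) : Continuous g :=
  isOpenQuotientMap_toTorus.isQuotientMap.continuous_iff.2 (ContDiff.continuous hg)

theorem Sm.add {f g : Torus d → ℝ} (hf : Sm f) (hg : Sm g) : Sm fun x => f x + g x :=
  ContDiff.add hf hg

theorem Sm.sub {f g : Torus d → ℝ} (hf : Sm f) (hg : Sm g) : Sm fun x => f x - g x :=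
  ContDiff.sub hf hg

theorem Sm.mul {f g : Torus d → ℝ} (hf : Sm f) (hg : Sm g) : Sm fun x => f x * g x :=
  ContDiff.mul hf hg

theorem sm_const (c : ℝ) : Sm fun _ : Torus d => c := contDiff_const

theorem sm_sum {ι : Type*} {s : Finset ι} {f : ι → Torus d → ℝ} (hf : ∀ i ∈ s, Sm (f i)) :
    Sm fun x => ∑ i ∈ s, f i x :=
  ContDiff.sum (f := fun i (X : Vec d) => f i (toTorus X)) hf

theorem exists_bound_of_continuous {g : Torus d → ℝ} (hg : Continuous g) :
    ∃ C : ℝ, 0 ≤ C ∧ ∀ x, |g x| ≤ C := by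
  obtain ⟨C, hC⟩ := (isCompact_univ (X := Torus d)).exists_bound_of_continuousOn hg.continuousOn
  exact ⟨C, (norm_nonneg _).trans (hC 0 (mem_univ _)), fun x => hC x (mem_univ _)⟩

theorem integrable_of_continuous {g : Torus d → ℝ} (hg : Continuous g) : Integrable g := by
  obtain ⟨C, -, hC⟩ := exists_bound_of_continuous hg
  exact Integrable.of_bound hg.aestronglyMeasurable C (ae_of_all _ hC)

theorem Sm.integrable {g : Torus d → ℝ} (hg : Sm g) : Integrable g :=
  integrable_of_continuous hg.continuous

/-! ### Partial derivatives -/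

/-- The `j`-th coordinate vector, which is `0` for `j ≥ d`. -/
def coordVec (d : ℕ) (j : Fin 3) : Vec d :=
  if hj : j.1 < d then EuclideanSpace.single (⟨j.1, hj⟩ : Fin d) (1 : ℝ) else 0

/-- With the zero vector for a missing coordinate the curve is constant, so a single formula covers
both cases and later proofs need no case distinction. -/
theorem pderiv_eq (j : Fin 3) (g : Torus d → ℝ) (x : Torus d) :
    pderiv j g x = deriv (fun s : ℝ => g (x + toTorus (s • coordVec d j))) 0 := by
  unfold pderiv coordVec
  split_ifs with hj
  · rfl
  · simp [toTorus_zero]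

theorem pderiv_toTorus {g : Torus d → ℝ} (hg : Sm g) (j : Fin 3) (X : Vec d) :
    pderiv j g (toTorus X) = fderiv ℝ (fun Y : Vec d => g (toTorus Y)) X (coordVec d j) := by
  rw [pderiv_eq]
  simp_rw [← toTorus_add]
  exact (ContDiff.differentiable hg (by simp) X).lineDeriv_eq_fderiv

theorem Sm.pderiv {g : Torus d → ℝ} (hg : Sm g) (j : Fin 3) : Sm (pderiv j g) := by
  have : (fun X : Vec d => HallMHD.pderiv j g (toTorus X)) =
      fun X => fderiv ℝ (fun Y : Vec d => g (toTorus Y)) X (coordVec d j) := by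
    funext X; exact pderiv_toTorus hg j X
  unfold Sm; rw [this]
  exact (ContDiff.fderiv_right (m := ∞) hg (by simp)).clm_apply contDiff_const

theorem hasDerivAt_translate {g : Torus d → ℝ} (hg : Sm g) (j : Fin 3) (x : Torus d) (s : ℝ) :
    HasDerivAt (fun s : ℝ => g (x + toTorus (s • coordVec d j)))
      (pderiv j g (x + toTorus (s • coordVec d j))) s := by
  obtain ⟨X, rfl⟩ := surjective_toTorus x
  simp_rw [← toTorus_add]
  rw [pderiv_toTorus hg]
  have h1 := (ContDiff.differentiable hg (by simp) (X + s • coordVec d j)).hasFDerivAt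
  have h2 : HasDerivAt (fun s : ℝ => X + s • coordVec d j) (coordVec d j) s := by
    simpa using ((hasDerivAt_id s).smul_const (coordVec d j)).const_add X
  exact h1.comp_hasDerivAt s h2

theorem hasDerivAt_translate_zero {g : Torus d → ℝ} (hg : Sm g) (j : Fin 3) (x : Torus d) :
    HasDerivAt (fun s : ℝ => g (x + toTorus (s • coordVec d j))) (pderiv j g x) 0 := by
  simpa [toTorus_zero] using hasDerivAt_translate hg j x 0

theorem pderiv_add {f g : Torus d → ℝ} (hf : Sm f) (hg : Sm g) (j : Fin 3) (x : Torus d) :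
    pderiv j (fun z => f z + g z) x = pderiv j f x + pderiv j g x := by
  rw [pderiv_eq]
  exact ((hasDerivAt_translate_zero hf j x).add (hasDerivAt_translate_zero hg j x)).deriv

theorem pderiv_sub {f g : Torus d → ℝ} (hf : Sm f) (hg : Sm g) (j : Fin 3) (x : Torus d) :
    pderiv j (fun z => f z - g z) x = pderiv j f x - pderiv j g x := by
  rw [pderiv_eq]
  exact ((hasDerivAt_translate_zero hf j x).sub (hasDerivAt_translate_zero hg j x)).deriv

theorem pderiv_mul {f g : Torus d → ℝ} (hf : Sm f) (hg : Sm g) (j : Fin 3) (x : Torus d) :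
    pderiv j (fun z => f z * g z) x = pderiv j f x * g x + f x * pderiv j g x := by
  rw [pderiv_eq]
  have := ((hasDerivAt_translate_zero hf j x).fun_mul (hasDerivAt_translate_zero hg j x)).deriv
  simpa [toTorus_zero] using this

theorem pderiv_const (c : ℝ) (j : Fin 3) (x : Torus d) : pderiv j (fun _ => c) x = 0 := by
  simp [pderiv_eq]

theorem pderiv_const_mul (c : ℝ) (g : Torus d → ℝ) (j : Fin 3) (x : Torus d) :
    pderiv j (fun z => c * g z) x = c * pderiv j g x := by
  simp [pderiv_eq]

theorem pderiv_sum {ι : Type*} {s : Finset ι} {f : ι → Torus d → ℝ} (hf : ∀ i ∈ s, Sm (f i))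
    (j : Fin 3) (x : Torus d) :
    pderiv j (fun z => ∑ i ∈ s, f i z) x = ∑ i ∈ s, pderiv j (f i) x := by
  rw [pderiv_eq]
  exact (HasDerivAt.fun_sum fun i hi => hasDerivAt_translate_zero (hf i hi) j x).deriv

theorem pderiv_comm {g : Torus d → ℝ} (hg : Sm g) (i j : Fin 3) (x : Torus d) :
    pderiv i (pderiv j g) x = pderiv j (pderiv i g) x := by
  obtain ⟨X, rfl⟩ := surjective_toTorus x
  rw [pderiv_toTorus (hg.pderiv j), pderiv_toTorus (hg.pderiv i)]
  simp_rw [pderiv_toTorus hg]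
  have hd : DifferentiableAt ℝ (fderiv ℝ (fun Y : Vec d => g (toTorus Y))) X :=
    (ContDiff.fderiv_right (m := 1) hg (by norm_cast)).differentiable (by simp) X
  have hs : IsSymmSndFDerivAt ℝ (fun Y : Vec d => g (toTorus Y)) X :=
    ContDiffAt.isSymmSndFDerivAt (ContDiff.contDiffAt hg) (by simpa using (WithTop.coe_le_coe.2 (le_top : (2 : ℕ∞) ≤ ⊤) : ((2 : ℕ∞) : WithTop ℕ∞) ≤ ∞))
  rw [fderiv_clm_apply hd (by fun_prop), fderiv_clm_apply hd (by fun_prop)]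
  simpa using hs.eq (coordVec d i) (coordVec d j)

/-- The integral of the derivative along a translation of length one is a difference of two
translates of `g`, which have the same mean. By Fubini and translation invariance the same double
integral is the mean of the derivative. -/
theorem integral_pderiv {g : Torus d → ℝ} (hg : Sm g) (j : Fin 3) :
    ∫ x, pderiv j g x = 0 := by
  have hc : Continuous fun p : Torus d × ℝ => pderiv j g (p.1 + toTorus (p.2 • coordVec d j)) :=
    (hg.pderiv j).continuous.comp (continuous_fst.add
      (continuous_toTorus.comp (continuous_snd.smul continuous_const)))
  obtain ⟨C, -, hC⟩ := exists_bound_of_continuous (hg.pderiv j).continuous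
  have h1 : ∀ x, ∫ s in (0 : ℝ)..1, pderiv j g (x + toTorus (s • coordVec d j)) =
      g (x + toTorus ((1 : ℝ) • coordVec d j)) - g (x + toTorus ((0 : ℝ) • coordVec d j)) := fun x =>
    intervalIntegral.integral_eq_sub_of_hasDerivAt (fun s _ => hasDerivAt_translate hg j x s)
      ((hc.comp (by fun_prop : Continuous fun s : ℝ => (x, s))).intervalIntegrable _ _)
  have h2 : ∫ x, ∫ s in (0 : ℝ)..1, pderiv j g (x + toTorus (s • coordVec d j)) = 0 := by
    simp_rw [h1]
    rw [integral_sub (hg.integrable.comp_add_right _) (hg.integrable.comp_add_right _),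
      integral_add_right_eq_self g, integral_add_right_eq_self g, sub_self]
  simp_rw [intervalIntegral.integral_of_le zero_le_one] at h2
  rw [integral_integral_swap] at h2
  · simpa [integral_add_right_eq_self (pderiv j g)] using h2
  · exact Integrable.of_bound hc.aestronglyMeasurable C (ae_of_all _ fun p => hC _)

/-! ### Averages of translates -/

/-- A smooth kernel on `ℝ^d` supported in the ball of radius `r`. -/
structure IsKer (r : ℝ) (κ : Vec d → ℝ) : Prop where
  smooth : ContDiff ℝ ∞ κ
  supp : tsupport κ ⊆ Metric.ball 0 r

/-- The convolution of a function on the torus with a kernel on `ℝ^d`. -/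
def conv (κ : Vec d → ℝ) (f : Torus d → ℝ) (x : Torus d) : ℝ :=
  ∫ y, κ y * f (x - toTorus y)

/-- The partial derivative of a kernel. -/
def dker (j : Fin 3) (κ : Vec d → ℝ) (y : Vec d) : ℝ := fderiv ℝ κ y (coordVec d j)

theorem IsKer.mono {r s : ℝ} {κ : Vec d → ℝ} (hκ : IsKer r κ) (h : r ≤ s) : IsKer s κ :=
  ⟨hκ.smooth, hκ.supp.trans (Metric.ball_subset_ball h)⟩

theorem IsKer.hasCompactSupport {r : ℝ} {κ : Vec d → ℝ} (hκ : IsKer r κ) : HasCompactSupport κ :=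
  HasCompactSupport.intro (isCompact_closedBall (0 : Vec d) r) fun y hy => by
    by_contra h
    exact hy (Metric.ball_subset_closedBall (hκ.supp (subset_tsupport _ h)))

theorem IsKer.eq_zero {r : ℝ} {κ : Vec d → ℝ} (hκ : IsKer r κ) {y : Vec d}
    (hy : y ∉ Metric.ball (0 : Vec d) r) : κ y = 0 := by
  by_contra h
  exact hy (hκ.supp (subset_tsupport _ h))

theorem IsKer.exists_bound {r : ℝ} {κ : Vec d → ℝ} (hκ : IsKer r κ) :
    ∃ C : ℝ, 0 ≤ C ∧ ∀ y, |κ y| ≤ C := by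
  obtain ⟨C, hC⟩ := hκ.hasCompactSupport.exists_bound_of_continuous hκ.smooth.continuous
  exact ⟨C, (norm_nonneg _).trans (hC 0), hC⟩

theorem IsKer.integrable {r : ℝ} {κ : Vec d → ℝ} (hκ : IsKer r κ) : Integrable κ :=
  hκ.smooth.continuous.integrable_of_hasCompactSupport hκ.hasCompactSupport

theorem IsKer.dker {r : ℝ} {κ : Vec d → ℝ} (hκ : IsKer r κ) (j : Fin 3) : IsKer r (dker j κ) where
  smooth := (hκ.smooth.fderiv_right (m := ∞) (by simp)).clm_apply contDiff_const
  supp := by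
    refine (closure_mono fun y hy => ?_).trans ((tsupport_fderiv_subset ℝ (f := κ)).trans hκ.supp)
    rw [Function.mem_support] at hy ⊢
    intro h
    exact hy (by simp [HallMHD.dker, h])

theorem IsKer.neg {r : ℝ} {κ : Vec d → ℝ} (hκ : IsKer r κ) : IsKer r fun y => κ (-y) where
  smooth := hκ.smooth.comp contDiff_neg
  supp := by
    have : tsupport (fun y => κ (-y)) = -(tsupport κ) := by
      rw [tsupport, tsupport, ← image_neg_eq_neg, ← Homeomorph.coe_neg,
        Homeomorph.image_closure, Homeomorph.coe_neg, image_neg_eq_neg]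
      congr 1
    rw [this]
    intro y hy
    simpa using hκ.supp hy

/-! ### Convolution over one period: integrability, smoothness, commutation, adjoints -/

theorem integrableOn_cube {f : Torus d → ℝ} (hf : Integrable f) (x : Torus d) :
    IntegrableOn (fun y => f (x - toTorus y)) (cube d) :=
  measurePreserving_toTorus.integrable_comp_of_integrable (hf.comp_sub_left x)

theorem integral_cube (f : Torus d → ℝ) (hf : AEStronglyMeasurable f) (x : Torus d) :
    ∫ y in cube d, f (x - toTorus y) = ∫ z, f z := by
  rw [← integral_sub_left_eq_self f volume x]
  have h : AEStronglyMeasurable (fun z => f (x - z)) volume :=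
    hf.comp_quasiMeasurePreserving (quasiMeasurePreserving_sub_left volume x)
  rw [← measurePreserving_toTorus.map_eq] at h ⊢
  rw [integral_map measurable_toTorus.aemeasurable h]

theorem IsKer.support_subset {κ : Vec d → ℝ} (hκ : IsKer (1 / 2) κ) (f : Vec d → ℝ) :
    Function.support (fun y => κ y * f y) ⊆ cube d := fun y hy =>
  ball_subset_cube (by
    by_contra h
    exact hy (by simp [hκ.eq_zero h]))

theorem integrable_conv_kernel {κ : Vec d → ℝ} (hκ : IsKer (1 / 2) κ) {f : Torus d → ℝ}
    (hf : Integrable f) (x : Torus d) : Integrable fun y => κ y * f (x - toTorus y) := by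
  obtain ⟨C, -, hC⟩ := hκ.exists_bound
  rw [← integrableOn_iff_integrable_of_support_subset (hκ.support_subset _)]
  exact (integrableOn_cube hf x).bdd_mul hκ.smooth.continuous.aestronglyMeasurable
    (ae_of_all _ hC)

theorem integral_norm_conv_kernel_le {κ : Vec d → ℝ} (hκ : IsKer (1 / 2) κ) {C : ℝ}
    (hC : ∀ y, |κ y| ≤ C) {f : Torus d → ℝ} (hf : Integrable f) (x : Torus d) :
    ∫ y, ‖κ y * f (x - toTorus y)‖ ≤ C * ∫ z, |f z| := by
  have h1 : ∫ y, ‖κ y * f (x - toTorus y)‖ = ∫ y in cube d, ‖κ y * f (x - toTorus y)‖ := by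
    rw [setIntegral_eq_integral_of_forall_compl_eq_zero]
    intro y hy
    rw [norm_eq_zero]
    by_contra h
    exact hy (hκ.support_subset (fun y => f (x - toTorus y)) h)
  rw [h1, ← integral_cube (fun z => |f z|) hf.abs.aestronglyMeasurable x, ← integral_const_mul]
  refine integral_mono (integrable_conv_kernel hκ hf x).norm.integrableOn
    ((integrableOn_cube hf x).abs.const_mul C) fun y => ?_
  simp only [norm_mul, Real.norm_eq_abs]
  gcongr
  exact hC y

theorem abs_conv_le {κ : Vec d → ℝ} (hκ : IsKer (1 / 2) κ) {C : ℝ}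
    (hC : ∀ y, |κ y| ≤ C) {f : Torus d → ℝ} (hf : Integrable f) (x : Torus d) :
    |conv κ f x| ≤ C * ∫ z, |f z| :=
  (norm_integral_le_integral_norm _).trans (integral_norm_conv_kernel_le hκ hC hf x)

/-- Null sets pull back to null sets under reflection, translation and the quotient map on the cube.
Hence convolution is well defined on `L²` classes, at every point. -/
theorem conv_congr_ae {κ : Vec d → ℝ} (hκ : IsKer (1 / 2) κ) {f g : Torus d → ℝ}
    (h : f =ᵐ[volume] g) : conv κ f = conv κ g := by
  funext x
  unfold conv
  rw [← setIntegral_eq_integral_of_forall_compl_eq_zero (s := cube d),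
    ← setIntegral_eq_integral_of_forall_compl_eq_zero (s := cube d)
      (f := fun y => κ y * g (x - toTorus y))]
  · refine integral_congr_ae ?_
    have h1 := (quasiMeasurePreserving_sub_left (volume : Measure (Torus d)) x).ae h
    have h2 := measurePreserving_toTorus.quasiMeasurePreserving.ae h1
    filter_upwards [h2] with y hy
    rw [hy]
  · exact fun y hy => by_contra fun h => hy (hκ.support_subset (fun y => g (x - toTorus y)) h)
  · exact fun y hy => by_contra fun h => hy (hκ.support_subset (fun y => f (x - toTorus y)) h)

theorem conv_add {κ : Vec d → ℝ} (hκ : IsKer (1 / 2) κ) {f g : Torus d → ℝ}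
    (hf : Integrable f) (hg : Integrable g) (x : Torus d) :
    conv κ (fun z => f z + g z) x = conv κ f x + conv κ g x := by
  unfold conv
  rw [← integral_add (integrable_conv_kernel hκ hf x) (integrable_conv_kernel hκ hg x)]
  simp_rw [mul_add]

theorem conv_sub {κ : Vec d → ℝ} (hκ : IsKer (1 / 2) κ) {f g : Torus d → ℝ}
    (hf : Integrable f) (hg : Integrable g) (x : Torus d) :
    conv κ (fun z => f z - g z) x = conv κ f x - conv κ g x := by
  unfold conv
  rw [← integral_sub (integrable_conv_kernel hκ hf x) (integrable_conv_kernel hκ hg x)]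
  simp_rw [mul_sub]

theorem conv_zero (κ : Vec d → ℝ) : conv κ (fun _ => 0) = fun _ => 0 := by
  funext x; simp [conv]

theorem locallyIntegrable_lift {f : Torus d → ℝ} (hf : Integrable f) :
    LocallyIntegrable fun X : Vec d => f (toTorus X) := by
  intro X
  refine ⟨Metric.ball X (1 / 2), Metric.ball_mem_nhds _ (by norm_num), ?_⟩
  have h1 : IntegrableOn (fun y : Vec d => f (toTorus (X + y))) (Metric.ball 0 (1 / 2)) := by
    simp_rw [toTorus_add]
    exact IntegrableOn.mono_set
      (measurePreserving_toTorus.integrable_comp_of_integrable (hf.comp_add_left (toTorus X)))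
      ball_subset_cube
  have h2 := (measurePreserving_add_left (volume : Measure (Vec d)) X).integrableOn_comp_preimage
    (f := fun Y => f (toTorus Y)) (s := Metric.ball X (1 / 2))
    (Homeomorph.addLeft X).isClosedEmbedding.measurableEmbedding
  have h3 : (fun x => X + x) ⁻¹' Metric.ball X (1 / 2) = Metric.ball 0 (1 / 2) := by
    ext y; simp
  rw [h3] at h2
  exact h2.1 h1

/-- The bridge to convolution on Euclidean space, from which smoothness and the derivative formula
are inherited. -/
theorem conv_toTorus (κ : Vec d → ℝ) (f : Torus d → ℝ) (X : Vec d) :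
    conv κ f (toTorus X) =
      convolution (fun X : Vec d => f (toTorus X)) κ (ContinuousLinearMap.mul ℝ ℝ) volume X := by
  rw [convolution_eq_swap]
  simp [conv, toTorus_sub, mul_comm]

theorem sm_conv {r : ℝ} {κ : Vec d → ℝ} (hκ : IsKer r κ) {f : Torus d → ℝ}
    (hf : Integrable f) : Sm (conv κ f) := by
  unfold Sm
  simp_rw [conv_toTorus]
  exact hκ.hasCompactSupport.contDiff_convolution_right _ (locallyIntegrable_lift hf) hκ.smooth

theorem pderiv_conv {r : ℝ} {κ : Vec d → ℝ} (hκ : IsKer r κ) {f : Torus d → ℝ}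
    (hf : Integrable f) (j : Fin 3) : pderiv j (conv κ f) = conv (dker j κ) f := by
  funext x
  obtain ⟨X, rfl⟩ := surjective_toTorus x
  rw [pderiv_toTorus (sm_conv hκ hf), conv_toTorus]
  simp_rw [conv_toTorus]
  have h1 := hκ.hasCompactSupport.hasFDerivAt_convolution_right (ContinuousLinearMap.mul ℝ ℝ)
    (locallyIntegrable_lift hf) (hκ.smooth.of_le (by norm_cast)) X
  erw [h1.fderiv]
  rw [convolution_precompR_apply _ (locallyIntegrable_lift hf) (hκ.hasCompactSupport.fderiv ℝ)
    (hκ.smooth.continuous_fderiv (by simp))]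
  rfl

/-- Convolving the constant function 1 gives a constant; its derivative is the integral in question.
-/
theorem integral_dker {κ : Vec d → ℝ} (hκ : IsKer (1 / 2) κ) (j : Fin 3) :
    ∫ y, dker j κ y = 0 := by
  have h := congrFun (pderiv_conv hκ (f := fun _ => 1) (integrable_const 1) j) 0
  have h2 : conv κ (fun _ : Torus d => (1 : ℝ)) = fun _ => ∫ y, κ y := by
    funext x; simp [conv]
  rw [h2, pderiv_const] at h
  simpa [conv] using h.symm

theorem conv_comm {κ₁ κ₂ : Vec d → ℝ} (h₁ : IsKer (1 / 2) κ₁) (h₂ : IsKer (1 / 2) κ₂)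
    {f : Torus d → ℝ} (hf : Integrable f) (hfm : Measurable f) :
    conv κ₁ (conv κ₂ f) = conv κ₂ (conv κ₁ f) := by
  funext x
  obtain ⟨C, -, hC⟩ := h₂.exists_bound
  unfold conv
  simp_rw [← integral_const_mul]
  have hmeas : AEStronglyMeasurable (Function.uncurry fun y z : Vec d =>
      κ₁ y * (κ₂ z * f (x - toTorus y - toTorus z))) (volume.prod volume) := by
    refine Measurable.aestronglyMeasurable ?_
    have := h₁.smooth.continuous.measurable
    have := h₂.smooth.continuous.measurable
    have := measurable_toTorus (d := d)
    fun_prop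
  rw [integral_integral_swap]
  · simp_rw [mul_left_comm (κ₁ _), sub_right_comm x]
  · refine (integrable_prod_iff hmeas).2 ⟨ae_of_all _ fun y =>
      (integrable_conv_kernel h₂ hf (x - toTorus y)).const_mul (κ₁ y), ?_⟩
    refine Integrable.mono' (h₁.integrable.norm.mul_const (C * ∫ z, |f z|))
      hmeas.norm.integral_prod_right' (ae_of_all _ fun y => ?_)
    rw [Real.norm_of_nonneg (integral_nonneg fun _ => norm_nonneg _)]
    simp only [Function.uncurry_apply_pair, norm_mul (κ₁ y), integral_const_mul]
    gcongr
    exact integral_norm_conv_kernel_le h₂ hC hf _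

/-- The derivative is placed on the inner kernel, so that the outer mollification remains intact and
can later be moved to the other factor. -/
theorem pderiv_conv_conv {κ₁ κ₂ : Vec d → ℝ} (h₁ : IsKer (1 / 2) κ₁) (h₂ : IsKer (1 / 2) κ₂)
    {f : Torus d → ℝ} (hf : Integrable f) (hfm : Measurable f) (j : Fin 3) :
    pderiv j (conv κ₁ (conv κ₂ f)) = conv κ₁ (conv (dker j κ₂) f) := by
  rw [conv_comm h₁ h₂ hf hfm, pderiv_conv h₂ (sm_conv h₁ hf).integrable,
    conv_comm (h₂.dker j) h₁ hf hfm]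

/-- Fubini, with a bound uniform in the shift as hypothesis, so that it serves both an integrable
function against a bounded one and two square-integrable functions. -/
theorem integral_conv_mul {κ : Vec d → ℝ} (hκ : IsKer (1 / 2) κ) {f g : Torus d → ℝ}
    (hf : Measurable f) (hg : Measurable g) {C : ℝ}
    (hi : ∀ y, Integrable fun x => f (x - y) * g x) (hC : ∀ y, ∫ x, ‖f (x - y) * g x‖ ≤ C) :
    ∫ x, conv κ f x * g x = ∫ y, κ y * ∫ x, f (x - toTorus y) * g x := by
  unfold conv
  simp_rw [← integral_mul_const, ← integral_const_mul]
  have hmeas : AEStronglyMeasurable (Function.uncurry fun (x : Torus d) (y : Vec d) =>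
      κ y * f (x - toTorus y) * g x) (volume.prod volume) := by
    refine Measurable.aestronglyMeasurable ?_
    have := hκ.smooth.continuous.measurable
    have := measurable_toTorus (d := d)
    fun_prop
  rw [integral_integral_swap]
  · simp_rw [mul_assoc]
  · refine (integrable_prod_iff' hmeas).2 ⟨ae_of_all _ fun y => ?_, ?_⟩
    · simp only [Function.uncurry_apply_pair, mul_assoc]
      exact (hi _).const_mul _
    · refine Integrable.mono' (hκ.integrable.norm.mul_const C)
        hmeas.norm.prod_swap.integral_prod_right' (ae_of_all _ fun y => ?_)
      rw [Real.norm_of_nonneg (integral_nonneg fun _ => norm_nonneg _)]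
      simp only [Function.uncurry_apply_pair, mul_assoc, norm_mul (κ y),
        integral_const_mul]
      gcongr
      exact hC _

/-- The adjoint of a convolution is convolution with the reflected kernel; an even kernel is
therefore self-adjoint. -/
theorem integral_conv_mul_eq {κ : Vec d → ℝ} (hκ : IsKer (1 / 2) κ) {f g : Torus d → ℝ}
    (hf : Measurable f) (hfi : Integrable f) (hg : Continuous g) :
    ∫ x, conv κ f x * g x = ∫ x, f x * conv (fun y => κ (-y)) g x := by
  obtain ⟨C, hC0, hC⟩ := exists_bound_of_continuous hg
  have b1 : ∀ y : Torus d, Integrable fun x => f (x - y) * g x := fun y =>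
    (hfi.comp_sub_right y).mul_bdd hg.aestronglyMeasurable (ae_of_all _ hC)
  have b2 : ∀ y : Torus d, Integrable fun x => g (x - y) * f x := fun y =>
    hfi.bdd_mul (by fun_prop) (ae_of_all _ fun x => hC (x - y))
  rw [integral_conv_mul hκ hf hg.measurable b1 (C := (∫ x, |f x|) * C)]
  · simp_rw [mul_comm (f _) (conv _ _ _)]
    rw [integral_conv_mul hκ.neg hg.measurable hf b2 (C := C * ∫ x, |f x|)]
    · rw [← integral_neg_eq_self]
      refine integral_congr_ae (ae_of_all _ fun y => ?_)
      simp only [toTorus_neg, sub_neg_eq_add]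
      rw [← integral_sub_right_eq_self (fun x => f (x + toTorus y) * g x) (toTorus y)]
      simp [mul_comm]
    · intro y
      rw [← integral_const_mul]
      refine integral_mono (b2 y).norm (hfi.abs.const_mul C) fun x => ?_
      simp only [norm_mul, Real.norm_eq_abs]
      gcongr
      exact hC _
  · intro y
    rw [← integral_mul_const, ← integral_sub_right_eq_self (fun x => |f x| * C) y]
    refine integral_mono (b1 y).norm ((hfi.abs.comp_sub_right y).mul_const C) fun x => ?_
    simp only [norm_mul, Real.norm_eq_abs]
    gcongr
    exact hC _

theorem dker_neg {κ : Vec d → ℝ} (he : ∀ y, κ (-y) = κ y) (j : Fin 3) (y : Vec d) :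
    dker j κ (-y) = - dker j κ y := by
  have h : (fun y => κ (-y)) = κ := funext he
  have h2 := fderiv_comp_smul (𝕜 := ℝ) (f := κ) (x := y) (-1)
  simp only [neg_smul, one_smul, h] at h2
  simp [dker, h2]

theorem conv_neg_ker (κ : Vec d → ℝ) (f : Torus d → ℝ) (x : Torus d) :
    conv (fun y => -κ y) f x = - conv κ f x := by
  simp [conv, integral_neg]

/-! ### The energy flux through a mollifier -/

theorem conv_const_mul (c : ℝ) (κ : Vec d → ℝ) (f : Torus d → ℝ) :
    conv (fun y => c * κ y) f = fun x => c * conv κ f x := by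
  funext x
  simp only [conv, mul_assoc, integral_const_mul]

/-- Mollification of a weakly divergence-free field is divergence-free. -/
theorem sum_pderiv_conv_eq_zero {κ : Vec d → ℝ} (hκ : IsKer (1 / 2) κ) (he : ∀ y, κ (-y) = κ y)
    {v : Fin 3 → Torus d → ℝ} (hm : ∀ i, Measurable (v i)) (hi : ∀ i, Integrable (v i))
    (hv : ∀ ψ : Torus d → ℝ, Sm ψ → ∫ x, ∑ j : Fin 3, v j x * pderiv j ψ x = 0) (x : Torus d) :
    ∑ j : Fin 3, pderiv j (conv κ (v j)) x = 0 := by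
  -- The divergence `q` is smooth. Testing the weak condition with the mollification of `q` itself
  -- gives `∫ q² = 0`, and continuity upgrades this to every point.
  set q : Torus d → ℝ := fun x => ∑ j : Fin 3, pderiv j (conv κ (v j)) x with hq
  have hqs : Sm q := sm_sum fun j _ => (sm_conv hκ (hi j)).pderiv j
  -- The sign comes from the derivative of an even kernel being odd.
  have h1 : ∀ j, ∫ x, pderiv j (conv κ (v j)) x * q x = - ∫ x, v j x * pderiv j (conv κ q) x := by
    intro j
    rw [pderiv_conv hκ (hi j), integral_conv_mul_eq (hκ.dker j) (hm j) (hi j) hqs.continuous,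
      pderiv_conv hκ hqs.integrable, ← integral_neg]
    refine integral_congr_ae (ae_of_all _ fun x => ?_)
    simp only [dker_neg he, conv_neg_ker, mul_neg]
  have hint : ∀ j, Integrable fun x => v j x * pderiv j (conv κ q) x := fun j => by
    obtain ⟨C, -, hC⟩ := exists_bound_of_continuous ((sm_conv hκ hqs.integrable).pderiv j).continuous
    exact (hi j).mul_bdd ((sm_conv hκ hqs.integrable).pderiv j).continuous.aestronglyMeasurable
      (ae_of_all _ hC)
  have h2 : ∫ x, q x * q x = 0 := by
    calc ∫ x, q x * q x = ∫ x, ∑ j : Fin 3, pderiv j (conv κ (v j)) x * q x := by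
          simp_rw [← Finset.sum_mul]; rfl
      _ = ∑ j : Fin 3, ∫ x, pderiv j (conv κ (v j)) x * q x :=
          integral_finsetSum _ fun j _ => (((sm_conv hκ (hi j)).pderiv j).mul hqs).integrable
      _ = -∫ x, ∑ j : Fin 3, v j x * pderiv j (conv κ q) x := by
          rw [integral_finsetSum _ fun j _ => hint j]
          simp_rw [h1, Finset.sum_neg_distrib]
      _ = 0 := by rw [hv _ (sm_conv hκ hqs.integrable), neg_zero]
  have h3 : (fun x => q x * q x) = 0 :=
    ((hqs.mul hqs).continuous.ae_eq_iff_eq volume continuous_const).1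
      ((integral_eq_zero_iff_of_nonneg (fun x => mul_self_nonneg (q x))
        (hqs.mul hqs).integrable).1 h2)
  exact mul_self_eq_zero.1 (congrFun h3 x)

/-- The `i`-th component of the curl of a field given by its components. -/
def curlC (v : Fin 3 → Torus d → ℝ) (i : Fin 3) (x : Torus d) : ℝ :=
  pderiv (i + 1) (v (i + 2)) x - pderiv (i + 2) (v (i + 1)) x

theorem sm_curlC {v : Fin 3 → Torus d → ℝ} (hv : ∀ i, Sm (v i)) (i : Fin 3) : Sm (curlC v i) :=
  ((hv _).pderiv _).sub ((hv _).pderiv _)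

theorem sum_pderiv_curlC {v : Fin 3 → Torus d → ℝ} (hv : ∀ i, Sm (v i)) (x : Torus d) :
    ∑ i : Fin 3, pderiv i (curlC v i) x = 0 := by
  have h : ∀ i, pderiv i (curlC v i) x =
      pderiv i (pderiv (i + 1) (v (i + 2))) x - pderiv i (pderiv (i + 2) (v (i + 1))) x := fun i =>
    pderiv_sub ((hv _).pderiv _) ((hv _).pderiv _) i x
  simp only [h, Fin.sum_univ_three, Fin.isValue, zero_add, Fin.reduceAdd]
  rw [pderiv_comm (hv 2) 0 1, pderiv_comm (hv 1) 0 2, pderiv_comm (hv 0) 1 2]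
  ring

/-- The vector field whose divergence is the density of the flux of a smooth solution. -/
def fluxField (U H : Fin 3 → Torus d → ℝ) (j : Fin 3) (x : Torus d) : ℝ :=
  (∑ i : Fin 3, (U i x * U i x + H i x * H i x)) * ((1 / 2) * U j x)
    - (∑ i : Fin 3, U i x * H i x) * H j x + (∑ i : Fin 3, curlC H i x * H i x) * H j x
    - (∑ i : Fin 3, H i x * H i x) * ((1 / 2) * curlC H j x)

theorem sm_fluxField {U H : Fin 3 → Torus d → ℝ} (hU : ∀ i, Sm (U i)) (hH : ∀ i, Sm (H i))
    (j : Fin 3) : Sm (fluxField U H j) := by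
  have hC := sm_curlC hH
  exact ((((sm_sum fun i _ => ((hU i).mul (hU i)).add ((hH i).mul (hH i))).mul
    ((sm_const _).mul (hU j))).sub ((sm_sum fun i _ => (hU i).mul (hH i)).mul (hH j))).add
    ((sm_sum fun i _ => (hC i).mul (hH i)).mul (hH j))).sub
    ((sm_sum fun i _ => (hH i).mul (hH i)).mul ((sm_const _).mul (hC j)))

theorem pderiv_fluxField {U H : Fin 3 → Torus d → ℝ} (hU : ∀ i, Sm (U i)) (hH : ∀ i, Sm (H i))
    (j : Fin 3) (x : Torus d) :
    pderiv j (fluxField U H j) x =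
      (∑ i : Fin 3, (2 * pderiv j (U i) x * U i x + 2 * pderiv j (H i) x * H i x)) *
          ((1 / 2) * U j x)
        + (∑ i : Fin 3, (U i x * U i x + H i x * H i x)) * ((1 / 2) * pderiv j (U j) x)
        - ((∑ i : Fin 3, (pderiv j (U i) x * H i x + U i x * pderiv j (H i) x)) * H j x
          + (∑ i : Fin 3, U i x * H i x) * pderiv j (H j) x)
        + ((∑ i : Fin 3, (pderiv j (curlC H i) x * H i x + curlC H i x * pderiv j (H i) x)) * H j x
          + (∑ i : Fin 3, curlC H i x * H i x) * pderiv j (H j) x)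
        - ((∑ i : Fin 3, 2 * pderiv j (H i) x * H i x) * ((1 / 2) * curlC H j x)
          + (∑ i : Fin 3, H i x * H i x) * ((1 / 2) * pderiv j (curlC H j) x)) := by
  have hC := sm_curlC hH
  have s1 : Sm fun x => ∑ i : Fin 3, (U i x * U i x + H i x * H i x) :=
    sm_sum fun i _ => ((hU i).mul (hU i)).add ((hH i).mul (hH i))
  have s2 : Sm fun x => ∑ i : Fin 3, U i x * H i x := sm_sum fun i _ => (hU i).mul (hH i)
  have s3 : Sm fun x => ∑ i : Fin 3, curlC H i x * H i x := sm_sum fun i _ => (hC i).mul (hH i)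
  have s4 : Sm fun x => ∑ i : Fin 3, H i x * H i x := sm_sum fun i _ => (hH i).mul (hH i)
  have t1 : Sm fun x => (1 / 2) * U j x := (sm_const _).mul (hU j)
  have t2 : Sm fun x => (1 / 2) * curlC H j x := (sm_const _).mul (hC j)
  unfold fluxField
  rw [pderiv_sub (((s1.mul t1).sub (s2.mul (hH j))).add (s3.mul (hH j))) (s4.mul t2),
    pderiv_add ((s1.mul t1).sub (s2.mul (hH j))) (s3.mul (hH j)),
    pderiv_sub (s1.mul t1) (s2.mul (hH j)), pderiv_mul s1 t1, pderiv_mul s2 (hH j),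
    pderiv_mul s3 (hH j), pderiv_mul s4 t2, pderiv_const_mul, pderiv_const_mul,
    pderiv_sum fun i _ => ((hU i).mul (hU i)).add ((hH i).mul (hH i)),
    pderiv_sum fun i _ => (hU i).mul (hH i), pderiv_sum fun i _ => (hC i).mul (hH i),
    pderiv_sum fun i _ => (hH i).mul (hH i)]
  have e1 : ∀ i, pderiv j (fun x => U i x * U i x + H i x * H i x) x =
      2 * pderiv j (U i) x * U i x + 2 * pderiv j (H i) x * H i x := fun i => by
    rw [pderiv_add ((hU i).mul (hU i)) ((hH i).mul (hH i)), pderiv_mul (hU i) (hU i),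
      pderiv_mul (hH i) (hH i)]
    ring
  have e2 : ∀ i, pderiv j (fun x => H i x * H i x) x = 2 * pderiv j (H i) x * H i x := fun i => by
    rw [pderiv_mul (hH i) (hH i)]
    ring
  simp_rw [e1, e2, fun i => pderiv_mul (hU i) (hH i) j x, fun i => pderiv_mul (hC i) (hH i) j x]

/-- For divergence-free `U`, `H` the convective terms combine into the divergence of `½(|U|² +
|H|²)U - (U·H)H`. For the Hall term put `J = curl H`: since `(J × H)·J = 0`, one may replace `H_j
∂_j H_i J_i` by `J·∇(|H|²/2)`, which leaves the divergence of `(J·H)H - ½|H|²J`. -/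
theorem sum_pderiv_fluxField {U H : Fin 3 → Torus d → ℝ} (hU : ∀ i, Sm (U i))
    (hH : ∀ i, Sm (H i)) {x : Torus d} (dU : ∑ j : Fin 3, pderiv j (U j) x = 0)
    (dH : ∑ j : Fin 3, pderiv j (H j) x = 0) :
    ∑ j : Fin 3, pderiv j (fluxField U H j) x = ∑ i : Fin 3, ∑ j : Fin 3,
      (pderiv j (U i) x * (U i x * U j x - H i x * H j x)
        + pderiv j (H i) x * (H i x * U j x - U i x * H j x)
        + pderiv j (curlC H i) x * (H i x * H j x)) := by
  have dC := sum_pderiv_curlC hH x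
  simp_rw [pderiv_fluxField hU hH]
  have c0 : curlC H 0 x = pderiv 1 (H 2) x - pderiv 2 (H 1) x := rfl
  have c1 : curlC H 1 x = pderiv 2 (H 0) x - pderiv 0 (H 2) x := rfl
  have c2 : curlC H 2 x = pderiv 0 (H 1) x - pderiv 1 (H 0) x := rfl
  simp only [Fin.sum_univ_three] at dU dH dC ⊢
  rw [c0, c1, c2]
  -- The coefficients are the undifferentiated factors that the product rule puts in front of `div
  -- U`, `div H` and `div curl H`.
  linear_combination
    ((1 / 2) * (U 0 x * U 0 x + H 0 x * H 0 x + (U 1 x * U 1 x + H 1 x * H 1 x)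
      + (U 2 x * U 2 x + H 2 x * H 2 x))) * dU
    + (-(U 0 x * H 0 x + U 1 x * H 1 x + U 2 x * H 2 x)
      + ((pderiv 1 (H 2) x - pderiv 2 (H 1) x) * H 0 x
      + (pderiv 2 (H 0) x - pderiv 0 (H 2) x) * H 1 x
      + (pderiv 0 (H 1) x - pderiv 1 (H 0) x) * H 2 x)) * dH
    - ((1 / 2) * (H 0 x * H 0 x + H 1 x * H 1 x + H 2 x * H 2 x)) * dC

/-- The commutator of mollification and multiplication. -/
def commut (κ : Vec d → ℝ) (f g : Torus d → ℝ) (x : Torus d) : ℝ :=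
  conv κ (fun z => f z * g z) x - conv κ f x * conv κ g x

theorem sm_commut {κ : Vec d → ℝ} (hκ : IsKer (1 / 2) κ) {f g : Torus d → ℝ} (hf : Integrable f)
    (hg : Integrable g) (hfg : Integrable fun z => f z * g z) : Sm (commut κ f g) :=
  (sm_conv hκ hfg).sub ((sm_conv hκ hf).mul (sm_conv hκ hg))

/-- The energy flux through the mollifier with kernel `κ`. -/
def flux (κ : Vec d → ℝ) (u h : Fin 3 → Torus d → ℝ) : ℝ :=
  ∑ i : Fin 3, ∑ j : Fin 3,
    ((∫ x, pderiv j (conv κ (u i)) x * conv κ (fun z => u i z * u j z - h i z * h j z) x)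
      + (∫ x, pderiv j (conv κ (h i)) x * conv κ (fun z => h i z * u j z - u i z * h j z) x)
      + ∫ x, pderiv j (curlC (fun k => conv κ (h k)) i) x * conv κ (fun z => h i z * h j z) x)

/-- The difference of the two sides is the flux with each mollified product replaced by the product
of mollifications. Its integrand is the divergence of `fluxField`, so it vanishes. -/
theorem flux_eq_commut {κ : Vec d → ℝ} (hκ : IsKer (1 / 2) κ) (he : ∀ y, κ (-y) = κ y)
    {u h : Fin 3 → Torus d → ℝ} (hum : ∀ i, Measurable (u i)) (hhm : ∀ i, Measurable (h i))
    (hu : ∀ i, MemLp (u i) 2) (hh : ∀ i, MemLp (h i) 2)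
    (du : ∀ ψ : Torus d → ℝ, Sm ψ → ∫ x, ∑ j : Fin 3, u j x * pderiv j ψ x = 0)
    (dh : ∀ ψ : Torus d → ℝ, Sm ψ → ∫ x, ∑ j : Fin 3, h j x * pderiv j ψ x = 0) :
    flux κ u h = ∑ i : Fin 3, ∑ j : Fin 3,
      ((∫ x, pderiv j (conv κ (u i)) x * commut κ (u i) (u j) x)
        - (∫ x, pderiv j (conv κ (u i)) x * commut κ (h i) (h j) x)
        + ((∫ x, pderiv j (conv κ (h i)) x * commut κ (h i) (u j) x)
        - ∫ x, pderiv j (conv κ (h i)) x * commut κ (u i) (h j) x)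
        + ∫ x, pderiv j (curlC (fun k => conv κ (h k)) i) x * commut κ (h i) (h j) x) := by
  have iu : ∀ i, Integrable (u i) := fun i => (hu i).integrable (by norm_num)
  have ih : ∀ i, Integrable (h i) := fun i => (hh i).integrable (by norm_num)
  have iuu : ∀ i j, Integrable fun z => u i z * u j z := fun i j => (hu i).integrable_mul (hu j)
  have ihh : ∀ i j, Integrable fun z => h i z * h j z := fun i j => (hh i).integrable_mul (hh j)
  have iuh : ∀ i j, Integrable fun z => u i z * h j z := fun i j => (hu i).integrable_mul (hh j)
  have ihu : ∀ i j, Integrable fun z => h i z * u j z := fun i j => (hh i).integrable_mul (hu j)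
  have sU : ∀ i, Sm (conv κ (u i)) := fun i => sm_conv hκ (iu i)
  have sH : ∀ i, Sm (conv κ (h i)) := fun i => sm_conv hκ (ih i)
  have sC := sm_curlC sH
  have dU := sum_pderiv_conv_eq_zero hκ he hum iu du
  have dH := sum_pderiv_conv_eq_zero hκ he hhm ih dh
  have key : ∑ i : Fin 3, ∑ j : Fin 3, ∫ x,
      (pderiv j (conv κ (u i)) x * (conv κ (u i) x * conv κ (u j) x - conv κ (h i) x * conv κ (h j) x)
        + pderiv j (conv κ (h i)) x *
          (conv κ (h i) x * conv κ (u j) x - conv κ (u i) x * conv κ (h j) x)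
        + pderiv j (curlC (fun k => conv κ (h k)) i) x * (conv κ (h i) x * conv κ (h j) x)) = 0 := by
    have hs : ∀ i j : Fin 3, Sm fun x =>
        (pderiv j (conv κ (u i)) x *
          (conv κ (u i) x * conv κ (u j) x - conv κ (h i) x * conv κ (h j) x)
        + pderiv j (conv κ (h i)) x *
          (conv κ (h i) x * conv κ (u j) x - conv κ (u i) x * conv κ (h j) x)
        + pderiv j (curlC (fun k => conv κ (h k)) i) x * (conv κ (h i) x * conv κ (h j) x)) :=
      fun i j => ((((sU i).pderiv j).mul (((sU i).mul (sU j)).sub ((sH i).mul (sH j)))).add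
        (((sH i).pderiv j).mul (((sH i).mul (sU j)).sub ((sU i).mul (sH j))))).add
        (((sC i).pderiv j).mul ((sH i).mul (sH j)))
    simp_rw [← integral_finsetSum _ fun j _ => (hs _ j).integrable]
    rw [← integral_finsetSum _ fun i _ => (sm_sum fun j _ => hs i j).integrable]
    simp_rw [← sum_pderiv_fluxField sU sH (dU _) (dH _)]
    rw [integral_finsetSum _ fun j _ => ((sm_fluxField sU sH j).pderiv j).integrable]
    simp [integral_pderiv (sm_fluxField sU sH _)]
  rw [← sub_eq_zero, ← key, flux, ← Finset.sum_sub_distrib]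
  refine Finset.sum_congr rfl fun i _ => ?_
  rw [← Finset.sum_sub_distrib]
  refine Finset.sum_congr rfl fun j _ => ?_
  have pU := (sU i).pderiv j
  have pH := (sH i).pderiv j
  have pC := (sC i).pderiv j
  have cuu := pU.mul (sm_commut hκ (iu i) (iu j) (iuu i j))
  have chh := pU.mul (sm_commut hκ (ih i) (ih j) (ihh i j))
  have chu := pH.mul (sm_commut hκ (ih i) (iu j) (ihu i j))
  have cuh := pH.mul (sm_commut hκ (iu i) (ih j) (iuh i j))
  have chh' := pC.mul (sm_commut hκ (ih i) (ih j) (ihh i j))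
  have m1 := pU.mul (sm_conv hκ ((iuu i j).sub (ihh i j)))
  have m2 := pH.mul (sm_conv hκ ((ihu i j).sub (iuh i j)))
  have m3 := pC.mul (sm_conv hκ (ihh i j))
  simp only [Pi.sub_def] at m1 m2
  rw [← integral_add m1.integrable m2.integrable, ← integral_add (m1.add m2).integrable m3.integrable,
    ← integral_sub cuu.integrable chh.integrable, ← integral_sub chu.integrable cuh.integrable,
    ← integral_add (cuu.sub chh).integrable (chu.sub cuh).integrable,
    ← integral_add ((cuu.sub chh).add (chu.sub cuh)).integrable chh'.integrable,
    ← integral_sub ((m1.add m2).add m3).integrable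
      (((cuu.sub chh).add (chu.sub cuh)).add chh').integrable]
  refine integral_congr_ae (ae_of_all _ fun x => ?_)
  simp only [conv_sub hκ (iuu i j) (ihh i j), conv_sub hκ (ihu i j) (iuh i j), commut]
  ring

/-! ### Scaling of kernels and the flux estimate -/

/-- The rescaled kernel `ε^{-d} κ(·/ε)`. -/
def scaled (ε : ℝ) (κ : Vec d → ℝ) (y : Vec d) : ℝ := (ε ^ d)⁻¹ * κ (ε⁻¹ • y)

theorem isKer_scaled {ε : ℝ} (hε : 0 < ε) {κ : Vec d → ℝ} (hκ : IsKer 1 κ) :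
    IsKer ε (scaled ε κ) where
  smooth := contDiff_const.mul (hκ.smooth.comp (contDiff_const_smul ε⁻¹))
  supp := by
    have h1 : tsupport (scaled ε κ) ⊆ (fun y => ε⁻¹ • y) ⁻¹' tsupport κ := by
      refine closure_minimal (fun y hy => subset_tsupport _ ?_)
        ((isClosed_tsupport κ).preimage (by fun_prop))
      rw [Function.mem_support] at hy ⊢
      exact fun h => hy (by simp [scaled, h])
    intro y hy
    have := hκ.supp (h1 hy)
    rw [mem_ball_zero_iff, norm_smul, norm_inv, Real.norm_of_nonneg hε.le,
      inv_mul_lt_iff₀ hε, mul_one] at this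
    simpa using this

theorem dker_scaled (ε : ℝ) (κ : Vec d → ℝ) (hκ : ContDiff ℝ ∞ κ) (j : Fin 3) :
    dker j (scaled ε κ) = fun y => ε⁻¹ * scaled ε (dker j κ) y := by
  funext y
  have h : DifferentiableAt ℝ (fun y => κ (ε⁻¹ • y)) y :=
    (hκ.comp (contDiff_const_smul ε⁻¹)).differentiable (by simp) y
  have h2 := fderiv_comp_smul (𝕜 := ℝ) (f := κ) (x := y) ε⁻¹
  simp only [dker]
  unfold scaled
  rw [fderiv_const_mul h, h2]
  simp only [smul_apply, smul_eq_mul, dker]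
  ring

theorem integral_scaled {ε : ℝ} (hε : 0 < ε) (κ : Vec d → ℝ) :
    ∫ y, scaled ε κ y = ∫ y, κ y := by
  simp only [scaled, integral_const_mul]
  rw [Measure.integral_comp_inv_smul]
  have : 0 < ε ^ d := pow_pos hε d
  simp [abs_of_pos this, this.ne']

theorem scaled_neg {ε : ℝ} {κ : Vec d → ℝ} (he : ∀ y, κ (-y) = κ y) (y : Vec d) :
    scaled ε κ (-y) = scaled ε κ y := by
  simp [scaled, he]

/-- The constant of the average bound for a kernel bounded by `C`. -/
def avgConst (d : ℕ) (C : ℝ) : ENNReal :=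
  ENNReal.ofReal C * volume (Metric.ball (0 : Vec d) 1)

theorem avgConst_ne_top (C : ℝ) : avgConst d C ≠ ⊤ :=
  ENNReal.mul_ne_top ENNReal.ofReal_ne_top measure_ball_lt_top.ne

/-- The factor `ε^{-d}` of the kernel cancels the volume `ε^d |B_1|` of the ball, so the constant
does not depend on `ε`. -/
theorem enorm_integral_scaled_le {ε : ℝ} (hε : 0 < ε) {κ : Vec d → ℝ} (hκ : IsKer 1 κ) {C : ℝ}
    (hC : ∀ y, |κ y| ≤ C) (g : Vec d → ℝ) :
    ‖∫ y, scaled ε κ y * g y‖ₑ ≤ avgConst d C * ⨍⁻ y in Metric.ball (0 : Vec d) ε, ‖g y‖ₑ ∂volume := by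
  have hεd : 0 < ε ^ d := pow_pos hε d
  have hv : volume (Metric.ball (0 : Vec d) 1) ≠ 0 := (Metric.measure_ball_pos _ _ one_pos).ne'
  have hv' : volume (Metric.ball (0 : Vec d) 1) ≠ ⊤ := measure_ball_lt_top.ne
  calc ‖∫ y, scaled ε κ y * g y‖ₑ ≤ ∫⁻ y, ‖scaled ε κ y * g y‖ₑ := enorm_integral_le_lintegral_enorm _
    _ ≤ ∫⁻ y, (Metric.ball (0 : Vec d) ε).indicator
          (fun y => ENNReal.ofReal ((ε ^ d)⁻¹ * C) * ‖g y‖ₑ) y := by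
        refine lintegral_mono fun y => ?_
        by_cases hy : y ∈ Metric.ball (0 : Vec d) ε
        · rw [indicator_of_mem hy, enorm_mul]
          gcongr
          rw [Real.enorm_eq_ofReal_abs]
          refine ENNReal.ofReal_le_ofReal ?_
          rw [scaled, abs_mul, abs_of_pos (inv_pos.2 hεd)]
          gcongr
          exact hC _
        · simp [(isKer_scaled hε hκ).eq_zero hy]
    _ = ENNReal.ofReal ((ε ^ d)⁻¹ * C) * ∫⁻ y in Metric.ball (0 : Vec d) ε, ‖g y‖ₑ := by
        rw [lintegral_indicator measurableSet_ball, lintegral_const_mul' _ _ ENNReal.ofReal_ne_top]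
    _ = avgConst d C * ⨍⁻ y in Metric.ball (0 : Vec d) ε, ‖g y‖ₑ ∂volume := by
        rw [setLAverage_eq, Measure.addHaar_ball_of_pos volume (0 : Vec d) hε, avgConst,
          finrank_euclideanSpace_fin, ENNReal.ofReal_mul (inv_nonneg.2 hεd.le),
          ENNReal.ofReal_inv_of_pos hεd, ENNReal.div_eq_inv_mul,
          ENNReal.mul_inv (Or.inr hv') (Or.inr hv)]
        generalize volume (Metric.ball (0 : Vec d) 1) = V at hv hv'
        calc _ = (ENNReal.ofReal (ε ^ d))⁻¹ * ENNReal.ofReal C *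
              (∫⁻ y in Metric.ball (0 : Vec d) ε, ‖g y‖ₑ) * (V * V⁻¹) := by
              rw [ENNReal.mul_inv_cancel hv hv', mul_one]
          _ = _ := by ring

/-! ### Hölder on averages and the commutator estimate -/

theorem lintegral_le_cube {α : Type*} [MeasurableSpace α] {μ : Measure α} [IsProbabilityMeasure μ]
    {w : α → ENNReal} (hw : Measurable w) :
    ∫⁻ y, w y ∂μ ≤ (∫⁻ y, w y ^ (3 : ℝ) ∂μ) ^ (1 / 3 : ℝ) := by
  have := ENNReal.lintegral_mul_le_Lp_mul_Lq μ (p := 3) (q := 3 / 2)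
    (by rw [Real.holderConjugate_iff]; norm_num) hw.aemeasurable (measurable_one (α := ENNReal)).aemeasurable
  simpa using this

/-- Hölder against the constant 1 with exponents 3/2 and 3. The power 2/3 is kept as a product of
two cube roots, so that one further cube root completes the full power. -/
theorem lintegral_sq_le_cube {α : Type*} [MeasurableSpace α] {μ : Measure α}
    [IsProbabilityMeasure μ] {w : α → ENNReal} (hw : Measurable w) :
    ∫⁻ y, w y * w y ∂μ ≤
      (∫⁻ y, w y ^ (3 : ℝ) ∂μ) ^ (1 / 3 : ℝ) * (∫⁻ y, w y ^ (3 : ℝ) ∂μ) ^ (1 / 3 : ℝ) := by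
  have := ENNReal.lintegral_mul_le_Lp_mul_Lq μ (p := 3 / 2) (q := 3)
    (by rw [Real.holderConjugate_iff]; norm_num) (hw.mul hw).aemeasurable
    (measurable_one (α := ENNReal)).aemeasurable
  have h1 : ∀ y, (w y * w y) ^ (3 / 2 : ℝ) = w y ^ (3 : ℝ) := fun y => by
    rw [← sq, ← ENNReal.rpow_natCast, ← ENNReal.rpow_mul]; norm_num
  rw [← ENNReal.rpow_add_of_nonneg _ _ (by norm_num) (by norm_num)]
  simp only [Pi.mul_apply, h1, Pi.one_apply, ENNReal.one_rpow, lintegral_one, measure_univ,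
    mul_one] at this
  norm_num at this ⊢
  exact this

theorem rpow_third_cube (a : ENNReal) :
    a ^ (1 / 3 : ℝ) * (a ^ (1 / 3 : ℝ) * a ^ (1 / 3 : ℝ)) = a := by
  rw [← ENNReal.rpow_add_of_nonneg _ _ (by norm_num) (by norm_num),
    ← ENNReal.rpow_add_of_nonneg _ _ (by norm_num) (by norm_num)]
  norm_num

/-- Expand the increments and use that the kernel has integral one: every term containing an
unmollified value at `x` cancels. What remains is quadratic in increments. -/
theorem commut_eq {κ : Vec d → ℝ} (hκ : IsKer (1 / 2) κ) (h1 : ∫ y, κ y = 1) {f g : Torus d → ℝ}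
    (hf : Integrable f) (hg : Integrable g) (hfg : Integrable fun z => f z * g z) (x : Torus d) :
    commut κ f g x = (∫ y, κ y * ((f (x - toTorus y) - f x) * (g (x - toTorus y) - g x)))
      - (∫ y, κ y * (f (x - toTorus y) - f x)) * ∫ y, κ y * (g (x - toTorus y) - g x) := by
  have i1 := integrable_conv_kernel hκ hf x
  have i2 := integrable_conv_kernel hκ hg x
  have i3 := integrable_conv_kernel hκ hfg x
  have e1 : ∫ y, κ y * (f (x - toTorus y) - f x) = conv κ f x - f x := by
    simp_rw [mul_sub]
    rw [integral_sub i1 (hκ.integrable.mul_const _), integral_mul_const, h1, one_mul]; rfl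
  have e2 : ∫ y, κ y * (g (x - toTorus y) - g x) = conv κ g x - g x := by
    simp_rw [mul_sub]
    rw [integral_sub i2 (hκ.integrable.mul_const _), integral_mul_const, h1, one_mul]; rfl
  have e3 : ∫ y, κ y * ((f (x - toTorus y) - f x) * (g (x - toTorus y) - g x)) =
      conv κ (fun z => f z * g z) x - g x * conv κ f x - f x * conv κ g x + f x * g x := by
    have : ∀ y, κ y * ((f (x - toTorus y) - f x) * (g (x - toTorus y) - g x)) =
        κ y * (f (x - toTorus y) * g (x - toTorus y)) - g x * (κ y * f (x - toTorus y))
          - f x * (κ y * g (x - toTorus y)) + κ y * (f x * g x) := fun y => by ring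
    simp_rw [this]
    have i4 : Integrable fun y => κ y * (f (x - toTorus y) * g (x - toTorus y))
        - g x * (κ y * f (x - toTorus y)) := i3.sub (i1.const_mul (g x))
    have i5 : Integrable fun y => κ y * (f (x - toTorus y) * g (x - toTorus y))
        - g x * (κ y * f (x - toTorus y)) - f x * (κ y * g (x - toTorus y)) :=
      i4.sub (i2.const_mul (f x))
    rw [integral_add i5 (hκ.integrable.mul_const _),
      integral_sub i4 (i2.const_mul _), integral_sub i3 (i1.const_mul _),
      integral_const_mul, integral_const_mul, integral_mul_const, h1, one_mul]
    rfl
  rw [e1, e2, e3, commut]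
  ring

/-- A mean-zero mollification times a commutator is controlled by averaged cubed increments. -/
theorem enorm_integral_conv_mul_commut_le {ε : ℝ} (hε : 0 < ε) (hε' : ε ≤ 1 / 2)
    {ρ σ : Vec d → ℝ} (hρ : IsKer 1 ρ) (hσ : IsKer 1 σ) {C : ℝ} (hC : ∀ y, |ρ y| ≤ C)
    (hC' : ∀ y, |σ y| ≤ C) (hρ1 : ∫ y, ρ y = 1) (hσ0 : ∫ y, σ y = 0)
    {k f g : Torus d → ℝ} (hk : Integrable k) (hf : Integrable f) (hg : Integrable g)
    (hfg : Integrable fun z => f z * g z) {w : Torus d → Vec d → ENNReal}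
    (hw : ∀ x, Measurable (w x)) (bk : ∀ x y, ‖k (x - toTorus y) - k x‖ₑ ≤ w x y)
    (bf : ∀ x y, ‖f (x - toTorus y) - f x‖ₑ ≤ w x y)
    (bg : ∀ x y, ‖g (x - toTorus y) - g x‖ₑ ≤ w x y) :
    ‖∫ x, conv (scaled ε σ) k x * commut (scaled ε ρ) f g x‖ₑ ≤
      (avgConst d C * (avgConst d C + avgConst d C * avgConst d C)) *
        ∫⁻ x, ⨍⁻ y in Metric.ball (0 : Vec d) ε, w x y ^ (3 : ℝ) ∂volume := by
  have kρ := (isKer_scaled hε hρ).mono hε'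
  have kσ := (isKer_scaled hε hσ).mono hε'
  set A := avgConst d C with hA
  have hA' : A ≠ ⊤ := avgConst_ne_top C
  refine (enorm_integral_le_lintegral_enorm _).trans ?_
  rw [← lintegral_const_mul' _ _ (by finiteness)]
  refine lintegral_mono fun x => ?_
  set a := ⨍⁻ y in Metric.ball (0 : Vec d) ε, w x y ^ (3 : ℝ) ∂volume with ha
  have hv : volume (Metric.ball (0 : Vec d) ε) ≠ 0 := (Metric.measure_ball_pos _ _ hε).ne'
  have hv' : volume (Metric.ball (0 : Vec d) ε) ≠ ⊤ := measure_ball_lt_top.ne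
  -- The ball has positive finite measure, so the average is an integral against a probability
  -- measure, as the Hölder lemmas require.
  have : NeZero ((volume.restrict (Metric.ball (0 : Vec d) ε)) : Measure (Vec d)) :=
    ⟨by simpa [Measure.restrict_eq_zero] using hv⟩
  have : IsFiniteMeasure (volume.restrict (Metric.ball (0 : Vec d) ε)) :=
    ⟨by simpa using measure_ball_lt_top⟩
  have l1 : ⨍⁻ y in Metric.ball (0 : Vec d) ε, w x y ∂volume ≤ a ^ (1 / 3 : ℝ) := lintegral_le_cube (hw x)
  have l2 : ⨍⁻ y in Metric.ball (0 : Vec d) ε, w x y * w x y ∂volume ≤ a ^ (1 / 3 : ℝ) * a ^ (1 / 3 : ℝ) :=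
    lintegral_sq_le_cube (hw x)
  have B1 : ∀ {τ : Vec d → ℝ} {q : Torus d → ℝ}, IsKer 1 τ → (∀ y, |τ y| ≤ C) →
      (∀ x y, ‖q (x - toTorus y) - q x‖ₑ ≤ w x y) →
      ‖∫ y, scaled ε τ y * (q (x - toTorus y) - q x)‖ₑ ≤ A * a ^ (1 / 3 : ℝ) := by
    intro τ q hτ hτC hq
    refine (enorm_integral_scaled_le hε hτ hτC _).trans ?_
    refine mul_le_mul_right (le_trans (lintegral_mono fun y => hq x y) l1) _
  -- As `σ` has mean zero, the value `k x` may be subtracted under the integral, which produces the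
  -- third increment.
  have Bk : ‖conv (scaled ε σ) k x‖ₑ ≤ A * a ^ (1 / 3 : ℝ) := by
    refine le_trans (le_of_eq ?_) (B1 hσ hC' bk)
    congr 1
    simp_rw [mul_sub]
    rw [integral_sub (integrable_conv_kernel kσ hk x) (kσ.integrable.mul_const _),
      integral_mul_const, integral_scaled hε, hσ0, zero_mul, sub_zero]
    rfl
  have Bc : ‖commut (scaled ε ρ) f g x‖ₑ ≤
      (A + A * A) * (a ^ (1 / 3 : ℝ) * a ^ (1 / 3 : ℝ)) := by
    rw [commut_eq kρ (by rw [integral_scaled hε, hρ1]) hf hg hfg]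
    refine enorm_sub_le.trans ?_
    rw [add_mul]
    refine add_le_add ?_ ?_
    · refine (enorm_integral_scaled_le hε hρ hC _).trans ?_
      refine mul_le_mul_right (le_trans (lintegral_mono fun y => ?_) l2) _
      rw [enorm_mul]
      exact mul_le_mul' (bf x y) (bg x y)
    · rw [enorm_mul]
      refine (mul_le_mul' (B1 hρ hC bf) (B1 hρ hC bg)).trans (le_of_eq (by ring))
  rw [enorm_mul]
  refine (mul_le_mul' Bk Bc).trans (le_of_eq ?_)
  calc _ = A * (A + A * A) * (a ^ (1 / 3 : ℝ) * (a ^ (1 / 3 : ℝ) * a ^ (1 / 3 : ℝ))) := by ring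
    _ = _ := by rw [rpow_third_cube]

/-! ### The flux estimate for square-integrable fields -/

/-- The component map as a continuous linear functional. -/
def compCLM (m : ℕ) (i : Fin 3) : Vec m →L[ℝ] ℝ :=
  if hi : i.1 < m then EuclideanSpace.proj ⟨i.1, hi⟩ else 0

theorem compCLM_apply (i : Fin 3) (v : Vec m) : compCLM m i v = comp v i := by
  unfold compCLM comp; split_ifs <;> simp

theorem comp_sub (v w : Vec m) (i : Fin 3) : comp (v - w) i = comp v i - comp w i := by
  simp only [← compCLM_apply, map_sub]

theorem abs_comp_le (v : Vec m) (i : Fin 3) : |comp v i| ≤ ‖v‖ := by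
  unfold comp
  split_ifs with hi
  · exact PiLp.norm_apply_le v ⟨i.1, hi⟩
  · simp

theorem enorm_comp_sub_le (v w : Vec m) (i : Fin 3) : ‖comp v i - comp w i‖ₑ ≤ ‖w - v‖ₑ := by
  rw [← comp_sub, enorm_le_iff_norm_le, norm_sub_rev]
  exact abs_comp_le _ _

/-- The components of a square-integrable field. -/
def cf (v : L2 d m) (i : Fin 3) (x : Torus d) : ℝ := comp (v x) i

theorem enorm_cf_sub_le (v : L2 d m) (i : Fin 3) (x z : Torus d) :
    ‖cf v i z - cf v i x‖ₑ ≤ ‖v x - v z‖ₑ :=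
  enorm_comp_sub_le _ _ _

theorem measurable_L2 (v : L2 d m) : Measurable v := (Lp.stronglyMeasurable v).measurable

theorem measurable_cf (v : L2 d m) (i : Fin 3) : Measurable (cf v i) := by
  have : cf v i = fun x => compCLM m i (v x) := by funext x; rw [compCLM_apply]; rfl
  rw [this]
  exact (compCLM m i).continuous.measurable.comp (measurable_L2 v)

theorem memLp_cf (v : L2 d m) (i : Fin 3) : MemLp (cf v i) 2 :=
  (Lp.memLp v).of_le (measurable_cf v i).aestronglyMeasurable (ae_of_all _ fun _ => abs_comp_le _ _)

theorem integrable_cf (v : L2 d m) (i : Fin 3) : Integrable (cf v i) :=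
  (memLp_cf v i).integrable (by norm_num)

theorem integrable_cf_mul (v w : L2 d m) (i j : Fin 3) :
    Integrable fun x => cf v i x * cf w j x :=
  (memLp_cf v i).integrable_mul (memLp_cf w j)

/-- The averaged cubed increments at scale `ε`. -/
def incr (ε : ℝ) (v : L2 d m) : ENNReal :=
  ∫⁻ x : Torus d, ⨍⁻ y in Metric.ball (0 : Vec d) ε, ‖v x - v (x - toTorus y)‖ₑ ^ (3 : ℝ) ∂volume

/-- A field is weakly divergence-free. -/
def WDivFree (v : L2 d m) : Prop :=
  ∀ ψ : Torus d → ℝ, Sm ψ → ∫ x, ∑ j : Fin 3, cf v j x * pderiv j ψ x = 0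

/-- A symmetric mollifier with bounds on its first two derivatives. -/
structure IsMollifier (ρ : Vec d → ℝ) (C : ℝ) : Prop where
  isKer : IsKer 1 ρ
  even : ∀ y, ρ (-y) = ρ y
  nonneg : ∀ y, 0 ≤ ρ y
  integral_eq : ∫ y, ρ y = 1
  bound : ∀ y, |ρ y| ≤ C
  bound_dker : ∀ j y, |dker j ρ y| ≤ C
  bound_dker_dker : ∀ j a y, |dker j (dker a ρ) y| ≤ C

theorem exists_isMollifier (d : ℕ) : ∃ (ρ : Vec d → ℝ) (C : ℝ), IsMollifier ρ C := by
  let φ : ContDiffBump (0 : Vec d) := ⟨1 / 4, 1 / 2, by norm_num, by norm_num⟩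
  have hk : IsKer 1 (φ.normed volume) :=
    ⟨φ.contDiff_normed, by
      rw [φ.tsupport_normed_eq]
      exact Metric.closedBall_subset_ball (by norm_num)⟩
  obtain ⟨C₀, hC₀, h₀⟩ := hk.exists_bound
  choose C₁ hC₁ h₁ using fun j => (hk.dker j).exists_bound
  choose C₂ hC₂ h₂ using fun j a => ((hk.dker a).dker j).exists_bound
  have p₁ : 0 ≤ ∑ j, C₁ j := Finset.sum_nonneg fun j _ => hC₁ j
  have p₂ : 0 ≤ ∑ j, ∑ a, C₂ j a := Finset.sum_nonneg fun j _ => Finset.sum_nonneg fun a _ => hC₂ j a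
  -- Summing all the bounds gives one constant valid for the kernel and for every first and second
  -- derivative.
  refine ⟨φ.normed volume, C₀ + ∑ j, C₁ j + ∑ j, ∑ a, C₂ j a, hk, φ.normed_neg, φ.nonneg_normed,
    φ.integral_normed, fun y => ?_, fun j y => ?_, fun j a y => ?_⟩
  · linarith [h₀ y]
  · have := Finset.single_le_sum (f := C₁) (fun j _ => hC₁ j) (Finset.mem_univ j)
    linarith [h₁ j y]
  · have e₁ := Finset.single_le_sum (f := C₂ j) (fun a _ => hC₂ j a) (Finset.mem_univ a)
    have e₂ := Finset.single_le_sum (f := fun j => ∑ a, C₂ j a)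
      (fun j _ => Finset.sum_nonneg fun a _ => hC₂ j a) (Finset.mem_univ j)
    linarith [h₂ j a y]

theorem pderiv_conv_scaled {ε : ℝ} (hε : 0 < ε) {κ : Vec d → ℝ} (hκ : IsKer 1 κ)
    {f : Torus d → ℝ} (hf : Integrable f) (j : Fin 3) :
    pderiv j (conv (scaled ε κ) f) = fun x => ε⁻¹ * conv (scaled ε (dker j κ)) f x := by
  rw [pderiv_conv (isKer_scaled hε hκ) hf, dker_scaled ε κ hκ.smooth, conv_const_mul]

theorem pderiv_curlC_conv_scaled {ε : ℝ} (hε : 0 < ε) {κ : Vec d → ℝ} (hκ : IsKer 1 κ)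
    {f : Fin 3 → Torus d → ℝ} (hf : ∀ i, Integrable (f i)) (i j : Fin 3) (x : Torus d) :
    pderiv j (curlC (fun k => conv (scaled ε κ) (f k)) i) x =
      ε⁻¹ * ε⁻¹ * (conv (scaled ε (dker j (dker (i + 1) κ))) (f (i + 2)) x
        - conv (scaled ε (dker j (dker (i + 2) κ))) (f (i + 1)) x) := by
  have hs : ∀ a b, Sm (pderiv a (conv (scaled ε κ) (f b))) := fun a b =>
    (sm_conv (isKer_scaled hε hκ) (hf b)).pderiv a
  have h2 : ∀ a b, pderiv j (pderiv a (conv (scaled ε κ) (f b))) x =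
      ε⁻¹ * ε⁻¹ * conv (scaled ε (dker j (dker a κ))) (f b) x := fun a b => by
    rw [pderiv_conv_scaled hε hκ (hf b), pderiv_const_mul,
      pderiv_conv_scaled hε (hκ.dker a) (hf b), mul_assoc]
  unfold curlC
  rw [pderiv_sub (hs _ _) (hs _ _), h2, h2, mul_sub]

theorem measurable_incr_integrand (v : L2 d m) :
    Measurable fun p : Torus d × Vec d => ‖v p.1 - v (p.1 - toTorus p.2)‖ₑ := by
  have := measurable_L2 v
  have := measurable_toTorus (d := d)
  fun_prop

/-- Convexity of the cube, `(s + t)³ ≤ 4(s³ + t³)`, integrated. -/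
theorem lintegral_laverage_add_cube_le (ε : ℝ) {a b : Torus d → Vec d → ENNReal}
    (ha : Measurable (Function.uncurry a)) :
    ∫⁻ x : Torus d, ⨍⁻ y in Metric.ball (0 : Vec d) ε, (a x y + b x y) ^ (3 : ℝ) ∂volume ≤
    4 * ((∫⁻ x : Torus d, ⨍⁻ y in Metric.ball (0 : Vec d) ε, a x y ^ (3 : ℝ) ∂volume)
      + ∫⁻ x : Torus d, ⨍⁻ y in Metric.ball (0 : Vec d) ε, b x y ^ (3 : ℝ) ∂volume) := by
  have hm : Measurable fun p : Torus d × Vec d => a p.1 p.2 ^ (3 : ℝ) := ha.pow_const _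
  simp only [laverage]
  obtain ⟨μ, hμ⟩ : ∃ μ, μ = ((volume.restrict (Metric.ball (0 : Vec d) ε)) univ)⁻¹ •
    volume.restrict (Metric.ball (0 : Vec d) ε) := ⟨_, rfl⟩
  have : SFinite μ := by rw [hμ]; infer_instance
  rw [← hμ]
  have hp : ∀ s t : ENNReal, (s + t) ^ (3 : ℝ) ≤ 4 * (s ^ (3 : ℝ) + t ^ (3 : ℝ)) := fun s t => by
    have := ENNReal.rpow_add_le_mul_rpow_add_rpow s t (p := 3) (by norm_num)
    norm_num at this ⊢
    exact this
  have h1 : ∀ x, ∫⁻ y, (a x y + b x y) ^ (3 : ℝ) ∂μ ≤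
      4 * ((∫⁻ y, a x y ^ (3 : ℝ) ∂μ) + ∫⁻ y, b x y ^ (3 : ℝ) ∂μ) := fun x => by
    have hx : Measurable fun y => a x y ^ (3 : ℝ) :=
      hm.comp (measurable_const.prodMk measurable_id)
    rw [← lintegral_add_left hx,
      ← lintegral_const_mul' 4 _ ENNReal.ofNat_ne_top]
    exact lintegral_mono fun y => hp _ _
  refine (lintegral_mono h1).trans (le_of_eq ?_)
  rw [lintegral_const_mul' 4 _ ENNReal.ofNat_ne_top, lintegral_add_left]
  exact hm.lintegral_prod_right'

/-- Two majorants are kept apart because the Hall term costs `ε⁻²` but involves increments of `h`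
alone, whereas the terms containing `u` cost only `ε⁻¹`. The constants count terms: nine index pairs
with four convective commutators each give 36, and with two second derivatives from the curl give
18. -/
theorem enorm_flux_le_of_increments {ρ : Vec d → ℝ} {C : ℝ} (hρ : IsMollifier ρ C) {ε : ℝ}
    (hε : 0 < ε) (hε' : ε ≤ 1 / 2) {u h : Fin 3 → Torus d → ℝ} (hum : ∀ i, Measurable (u i))
    (hhm : ∀ i, Measurable (h i)) (hu : ∀ i, MemLp (u i) 2) (hh : ∀ i, MemLp (h i) 2)
    (du : ∀ ψ : Torus d → ℝ, Sm ψ → ∫ x, ∑ j : Fin 3, u j x * pderiv j ψ x = 0)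
    (dh : ∀ ψ : Torus d → ℝ, Sm ψ → ∫ x, ∑ j : Fin 3, h j x * pderiv j ψ x = 0)
    {w₁ w₂ : Torus d → Vec d → ENNReal} (mw₁ : ∀ x, Measurable (w₁ x))
    (mw₂ : ∀ x, Measurable (w₂ x))
    (bu' : ∀ i x y, ‖u i (x - toTorus y) - u i x‖ₑ ≤ w₁ x y)
    (bh' : ∀ i x y, ‖h i (x - toTorus y) - h i x‖ₑ ≤ w₁ x y)
    (bh : ∀ i x y, ‖h i (x - toTorus y) - h i x‖ₑ ≤ w₂ x y) :
    ‖flux (scaled ε ρ) u h‖ₑ ≤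
      (avgConst d C * (avgConst d C + avgConst d C * avgConst d C)) *
        (36 * (‖ε⁻¹‖ₑ *
            ∫⁻ x, ⨍⁻ y in Metric.ball (0 : Vec d) ε, w₁ x y ^ (3 : ℝ) ∂volume)
          + 18 * (‖ε⁻¹ * ε⁻¹‖ₑ *
            ∫⁻ x, ⨍⁻ y in Metric.ball (0 : Vec d) ε, w₂ x y ^ (3 : ℝ) ∂volume)) := by
  have kρ := (isKer_scaled hε hρ.isKer).mono hε'
  have iu : ∀ i, Integrable (u i) := fun i => (hu i).integrable (by norm_num)
  have ih : ∀ i, Integrable (h i) := fun i => (hh i).integrable (by norm_num)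
  have iuu : ∀ i j, Integrable fun z => u i z * u j z := fun i j => (hu i).integrable_mul (hu j)
  have ihh : ∀ i j, Integrable fun z => h i z * h j z := fun i j => (hh i).integrable_mul (hh j)
  have iuh : ∀ i j, Integrable fun z => u i z * h j z := fun i j => (hu i).integrable_mul (hh j)
  have ihu : ∀ i j, Integrable fun z => h i z * u j z := fun i j => (hh i).integrable_mul (hu j)
  -- `integral_dker` asks for support in the ball of radius 1/2, so it is applied to the rescaled
  -- kernel; scaling carries the zero mean back to `ρ`.
  have ki : ∀ j, ∫ y, dker j ρ y = 0 := fun j => by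
    have := integral_dker kρ j
    rw [dker_scaled ε ρ hρ.isKer.smooth, integral_const_mul, integral_scaled hε] at this
    exact (mul_eq_zero.1 this).resolve_left (inv_ne_zero hε.ne')
  have kii : ∀ j a, ∫ y, dker j (dker a ρ) y = 0 := fun j a => by
    have := integral_dker ((isKer_scaled hε (hρ.isKer.dker a)).mono hε') j
    rw [dker_scaled ε _ (hρ.isKer.dker a).smooth, integral_const_mul, integral_scaled hε] at this
    exact (mul_eq_zero.1 this).resolve_left (inv_ne_zero hε.ne')
  obtain ⟨A, hA⟩ : ∃ A, A = avgConst d C * (avgConst d C + avgConst d C * avgConst d C) := ⟨_, rfl⟩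
  obtain ⟨I₁, hI₁⟩ : ∃ I, I = ∫⁻ x, ⨍⁻ y in Metric.ball (0 : Vec d) ε, w₁ x y ^ (3 : ℝ) ∂volume :=
    ⟨_, rfl⟩
  obtain ⟨I₂, hI₂⟩ : ∃ I, I = ∫⁻ x, ⨍⁻ y in Metric.ball (0 : Vec d) ε, w₂ x y ^ (3 : ℝ) ∂volume :=
    ⟨_, rfl⟩
  rw [← hA, ← hI₁, ← hI₂]
  have T1 : ∀ {k f g : Torus d → ℝ} (j : Fin 3), Integrable k → Integrable f → Integrable g →
      (Integrable fun z => f z * g z) → (∀ x y, ‖k (x - toTorus y) - k x‖ₑ ≤ w₁ x y) →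
      (∀ x y, ‖f (x - toTorus y) - f x‖ₑ ≤ w₁ x y) →
      (∀ x y, ‖g (x - toTorus y) - g x‖ₑ ≤ w₁ x y) →
      ‖∫ x, pderiv j (conv (scaled ε ρ) k) x * commut (scaled ε ρ) f g x‖ₑ ≤
        ‖ε⁻¹‖ₑ * (A * I₁) := by
    intro k f g j hk hf hg hfg bk bf bg
    rw [pderiv_conv_scaled hε hρ.isKer hk]
    simp only [mul_assoc]
    rw [integral_const_mul, enorm_mul, hA, hI₁]
    exact mul_le_mul_right (enorm_integral_conv_mul_commut_le hε hε' hρ.isKer (hρ.isKer.dker j)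
      hρ.bound (hρ.bound_dker j) hρ.integral_eq (ki j) hk hf hg hfg mw₁ bk bf bg) _
  have T2 : ∀ i j, ‖∫ x, pderiv j (curlC (fun k => conv (scaled ε ρ) (h k)) i) x *
      commut (scaled ε ρ) (h i) (h j) x‖ₑ ≤ ‖ε⁻¹ * ε⁻¹‖ₑ * (A * I₂ + A * I₂) := by
    intro i j
    have hs : ∀ a b, Integrable fun x => conv (scaled ε (dker j (dker a ρ))) (h b) x *
        commut (scaled ε ρ) (h i) (h j) x := fun a b =>
      ((sm_conv (isKer_scaled hε ((hρ.isKer.dker a).dker j)) (ih b)).mul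
        (sm_commut kρ (ih i) (ih j) (ihh i j))).integrable
    have hb : ∀ a b, ‖∫ x, conv (scaled ε (dker j (dker a ρ))) (h b) x *
        commut (scaled ε ρ) (h i) (h j) x‖ₑ ≤ A * I₂ := fun a b => by
      rw [hA, hI₂]
      exact enorm_integral_conv_mul_commut_le hε hε' hρ.isKer ((hρ.isKer.dker _).dker j) hρ.bound
        (hρ.bound_dker_dker j _) hρ.integral_eq (kii j _) (ih b) (ih i)
        (ih j) (ihh i j) mw₂ (bh b) (bh i) (bh j)
    simp_rw [pderiv_curlC_conv_scaled hε hρ.isKer ih, mul_assoc (ε⁻¹ * ε⁻¹)]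
    rw [integral_const_mul, enorm_mul]
    simp_rw [sub_mul]
    rw [integral_sub (hs _ _) (hs _ _)]
    exact mul_le_mul_right (enorm_sub_le.trans (add_le_add (hb _ _) (hb _ _))) _
  rw [flux_eq_commut kρ (scaled_neg hρ.even) hum hhm hu hh du dh]
  calc _ ≤ ∑ i : Fin 3, ∑ j : Fin 3, (4 * (‖ε⁻¹‖ₑ * (A * I₁))
        + ‖ε⁻¹ * ε⁻¹‖ₑ * (A * I₂ + A * I₂)) := by
        refine (enorm_sum_le _ _).trans (Finset.sum_le_sum fun i _ => ?_)
        refine (enorm_sum_le _ _).trans (Finset.sum_le_sum fun j _ => ?_)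
        refine (enorm_add_le _ _).trans (add_le_add ?_ (T2 i j))
        refine (enorm_add_le _ _).trans ((add_le_add enorm_sub_le enorm_sub_le).trans ?_)
        refine (add_le_add (add_le_add
          (T1 j (iu i) (iu i) (iu j) (iuu i j) (bu' i) (bu' i) (bu' j))
          (T1 j (iu i) (ih i) (ih j) (ihh i j) (bu' i) (bh' i) (bh' j)))
          (add_le_add
          (T1 j (ih i) (ih i) (iu j) (ihu i j) (bh' i) (bh' i) (bu' j))
          (T1 j (ih i) (iu i) (ih j) (iuh i j) (bh' i) (bu' i) (bh' j)))).trans (le_of_eq (by ring))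
    _ = 36 * (‖ε⁻¹‖ₑ * (A * I₁)) + 9 * (‖ε⁻¹ * ε⁻¹‖ₑ * (A * I₂ + A * I₂)) := by
        simp only [Fin.sum_univ_three]
        ring
    _ = _ := by ring

/-- The convective majorant is the sum of the increments of `u` and `h`; splitting its cube turns 36
into 36 · 4 = 144. -/
theorem enorm_flux_le {ρ : Vec d → ℝ} {C : ℝ} (hρ : IsMollifier ρ C) {ε : ℝ} (hε : 0 < ε)
    (hε' : ε ≤ 1 / 2) {u h : L2 d m} (du : WDivFree u) (dh : WDivFree h) :
    ‖flux (scaled ε ρ) (cf u) (cf h)‖ₑ ≤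
      (avgConst d C * (avgConst d C + avgConst d C * avgConst d C)) *
        (144 * (‖ε⁻¹‖ₑ * (incr ε u + incr ε h)) + 18 * (‖ε⁻¹ * ε⁻¹‖ₑ * incr ε h)) := by
  have mw : ∀ (v : L2 d m) x, Measurable fun y => ‖v x - v (x - toTorus y)‖ₑ := fun v x => by
    have := measurable_L2 v
    have := measurable_toTorus (d := d)
    fun_prop
  refine (enorm_flux_le_of_increments hρ hε hε' (measurable_cf u) (measurable_cf h) (memLp_cf u)
    (memLp_cf h) du dh
    (w₁ := fun x y => ‖u x - u (x - toTorus y)‖ₑ + ‖h x - h (x - toTorus y)‖ₑ)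
    (w₂ := fun x y => ‖h x - h (x - toTorus y)‖ₑ) (fun x => (mw u x).add (mw h x)) (mw h)
    (fun i x y => (enorm_cf_sub_le u i x (x - toTorus y)).trans le_self_add)
    (fun i x y => (enorm_cf_sub_le h i x (x - toTorus y)).trans le_add_self)
    (fun i x y => enorm_cf_sub_le h i x (x - toTorus y))).trans ?_
  have h1 := lintegral_laverage_add_cube_le ε (a := fun x y => ‖u x - u (x - toTorus y)‖ₑ)
    (b := fun x y => ‖h x - h (x - toTorus y)‖ₑ) (measurable_incr_integrand u)
  have h2 : ∀ {e X Y : ENNReal}, X ≤ 4 * Y → 36 * (e * X) ≤ 144 * (e * Y) := fun {e X Y} h =>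
    calc 36 * (e * X) ≤ 36 * (e * (4 * Y)) := by gcongr
      _ = 144 * (e * Y) := by ring
  exact mul_le_mul_right (add_le_add (h2 h1) le_rfl) _

/-! ### Functions of time -/

/-- Scalar test functions on `(0, T)`. -/
structure IsTimeTest (T : ℝ) (θ : ℝ → ℝ) : Prop where
  smooth : ContDiff ℝ ∞ θ
  compact : HasCompactSupport θ
  support : tsupport θ ⊆ Ioo 0 T

/-- The fundamental lemma of the calculus of variations on the open interval; continuity adds the
endpoints, which matter because the energy identity is wanted at `0` and `T`. -/
theorem eq_zero_of_forall_integral_mul_eq_zero {T : ℝ} (hT : 0 < T) {φ : ℝ → ℝ}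
    (hφ : Continuous φ)
    (h : ∀ θ, IsTimeTest T θ → ∫ t in (0 : ℝ)..T, θ t * φ t = 0) :
    ∀ t ∈ Icc 0 T, φ t = 0 := by
  have h1 := isOpen_Ioo.ae_eq_zero_of_integral_contDiff_smul_eq_zero (μ := volume) (f := φ)
    (U := Ioo 0 T) (hφ.locallyIntegrable.locallyIntegrableOn _) fun θ hs hc hU => by
      rw [← h θ ⟨hs, hc, hU⟩, intervalIntegral.integral_of_le hT.le,
        setIntegral_eq_integral_of_forall_compl_eq_zero]
      · simp
      · intro t ht
        have : t ∉ tsupport θ := fun h => ht (Ioo_subset_Ioc_self (hU h))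
        simp [image_eq_zero_of_notMem_tsupport this]
  have h2 : EqOn φ 0 (Ioo 0 T) :=
    Measure.eqOn_open_of_ae_eq ((ae_restrict_iff' measurableSet_Ioo).2 h1) isOpen_Ioo
      hφ.continuousOn continuousOn_const
  have h3 := h2.closure hφ continuous_const
  rw [closure_Ioo hT.ne] at h3
  exact fun t ht => h3 ht

theorem IsTimeTest.sub_const_mul {T : ℝ} {θ χ : ℝ → ℝ} (hθ : IsTimeTest T θ) (hχ : IsTimeTest T χ)
    (c : ℝ) : IsTimeTest T fun t => θ t - c * χ t := by
  have hs : tsupport (fun t => θ t - c * χ t) ⊆ tsupport θ ∪ tsupport χ := by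
    refine closure_minimal (fun t ht => ?_) ((isClosed_tsupport θ).union (isClosed_tsupport χ))
    by_contra hn
    rw [mem_union, not_or] at hn
    exact ht (by simp [image_eq_zero_of_notMem_tsupport hn.1, image_eq_zero_of_notMem_tsupport hn.2])
  exact ⟨hθ.smooth.sub (contDiff_const.mul hχ.smooth),
    (hθ.compact.isCompact.union hχ.compact.isCompact).of_isClosed_subset (isClosed_tsupport _) hs,
    hs.trans (union_subset hθ.support hχ.support)⟩

/-- The primitive of a test function of mean zero is a test function. -/
theorem IsTimeTest.primitive {T : ℝ} (hT : 0 < T) {χ : ℝ → ℝ} (hχ : IsTimeTest T χ)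
    (h0 : ∫ t in (0 : ℝ)..T, χ t = 0) :
    IsTimeTest T (fun t => ∫ r in (0 : ℝ)..t, χ r) ∧
      deriv (fun t => ∫ r in (0 : ℝ)..t, χ r) = χ := by
  have hc : Continuous χ := hχ.smooth.continuous
  have hd : deriv (fun t => ∫ r in (0 : ℝ)..t, χ r) = χ := by
    funext t; exact hc.deriv_integral _ _ _
  -- The midpoint is added only to make the compact set nonempty, so that it has a least and a
  -- greatest element.
  set K := insert (T / 2) (tsupport χ) with hK
  have hKc : IsCompact K := hχ.compact.isCompact.insert _
  have hKT : K ⊆ Ioo 0 T := insert_subset ⟨by linarith, by linarith⟩ hχ.support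
  obtain ⟨a, ha⟩ := hKc.exists_isLeast ⟨_, mem_insert _ _⟩
  obtain ⟨b, hb⟩ := hKc.exists_isGreatest ⟨_, mem_insert _ _⟩
  have z : ∀ t, t ∉ K → χ t = 0 := fun t ht =>
    image_eq_zero_of_notMem_tsupport fun h => ht (mem_insert_of_mem _ h)
  have hs : Function.support (fun t => ∫ r in (0 : ℝ)..t, χ r) ⊆ Icc a b := by
    intro t ht
    by_contra hn
    rw [mem_Icc, not_and_or, not_le, not_le] at hn
    refine ht ?_
    rcases hn with hn | hn
    · refine intervalIntegral.integral_zero_ae (ae_of_all _ fun r hr => z r fun hrK => ?_)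
      have h1 := ha.2 hrK
      have h2 := (hKT ha.1).1
      rcases mem_uIoc.1 hr with h | h <;> linarith [h.1, h.2]
    -- To the right of the support the primitive vanishes because the mean over `[0, T]` is zero.
    · simp only
      rw [← intervalIntegral.integral_add_adjacent_intervals (hc.intervalIntegrable 0 T)
        (hc.intervalIntegrable T t), h0, zero_add]
      refine intervalIntegral.integral_zero_ae (ae_of_all _ fun r hr => z r fun hrK => ?_)
      have h1 := hb.2 hrK
      have h2 := (hKT hb.1).2
      rcases mem_uIoc.1 hr with h | h <;> linarith [h.1, h.2]
  have hs' : tsupport (fun t => ∫ r in (0 : ℝ)..t, χ r) ⊆ Icc a b := closure_minimal hs isClosed_Icc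
  refine ⟨⟨contDiff_infty_iff_deriv.2 ⟨fun t => ?_, by rw [hd]; exact hχ.smooth⟩,
    isCompact_Icc.of_isClosed_subset (isClosed_tsupport _) hs',
    hs'.trans (Icc_subset_Ioo (hKT ha.1).1 (hKT hb.1).2)⟩, hd⟩
  exact (hc.integral_hasStrictDerivAt 0 t).hasDerivAt.differentiableAt

theorem IsTimeTest.continuous_deriv {T : ℝ} {θ : ℝ → ℝ} (hθ : IsTimeTest T θ) :
    Continuous (deriv θ) := hθ.smooth.continuous_deriv (by simp)

theorem IsTimeTest.apply_zero {T : ℝ} {θ : ℝ → ℝ} (hθ : IsTimeTest T θ) : θ 0 = 0 :=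
  image_eq_zero_of_notMem_tsupport fun h => lt_irrefl _ (hθ.support h).1

theorem IsTimeTest.apply_end {T : ℝ} {θ : ℝ → ℝ} (hθ : IsTimeTest T θ) : θ T = 0 :=
  image_eq_zero_of_notMem_tsupport fun h => lt_irrefl _ (hθ.support h).2

theorem exists_isTimeTest {T : ℝ} (hT : 0 < T) :
    ∃ χ, IsTimeTest T χ ∧ ∫ t in (0 : ℝ)..T, χ t = 1 := by
  let φ : ContDiffBump (T / 2) := ⟨T / 8, T / 4, by linarith, by linarith⟩
  have hs : tsupport (φ.normed volume) ⊆ Ioo 0 T := by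
    rw [φ.tsupport_normed_eq, Real.closedBall_eq_Icc]
    exact Icc_subset_Ioo (by change 0 < T / 2 - T / 4; linarith)
      (by change T / 2 + T / 4 < T; linarith)
  refine ⟨φ.normed volume, ⟨φ.contDiff_normed, φ.hasCompactSupport_normed, hs⟩, ?_⟩
  rw [intervalIntegral.integral_of_le hT.le, setIntegral_eq_integral_of_forall_compl_eq_zero,
    φ.integral_normed]
  exact fun t ht => image_eq_zero_of_notMem_tsupport fun h => ht (Ioo_subset_Ioc_self (hs h))

theorem intervalIntegral_add_of_continuous {p q : ℝ → ℝ} (a b : ℝ) (hp : Continuous p)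
    (hq : Continuous q) :
    ∫ x in a..b, (p x + q x) = (∫ x in a..b, p x) + ∫ x in a..b, q x :=
  intervalIntegral.integral_add (hp.intervalIntegrable _ _) (hq.intervalIntegrable _ _)

theorem intervalIntegral_sub_of_continuous {p q : ℝ → ℝ} (a b : ℝ) (hp : Continuous p)
    (hq : Continuous q) :
    ∫ x in a..b, (p x - q x) = (∫ x in a..b, p x) - ∫ x in a..b, q x :=
  intervalIntegral.integral_sub (hp.intervalIntegrable _ _) (hq.intervalIntegrable _ _)

/-- A continuous function with continuous distributional derivative is its primitive. -/
theorem sub_eq_integral_of_forall_test {T : ℝ} (hT : 0 < T) {f g : ℝ → ℝ} (hf : Continuous f)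
    (hg : Continuous g)
    (h : ∀ θ, IsTimeTest T θ → ∫ t in (0 : ℝ)..T, (deriv θ t * f t + θ t * g t) = 0)
    {s t : ℝ} (hs : s ∈ Icc 0 T) (ht : t ∈ Icc 0 T) : f t - f s = ∫ r in s..t, g r := by
  set P : ℝ → ℝ := fun t => ∫ r in (0 : ℝ)..t, g r with hP
  have hPd : ∀ t, HasDerivAt P (g t) t := fun t => (hg.integral_hasStrictDerivAt 0 t).hasDerivAt
  have hPc : Continuous P := continuous_iff_continuousAt.2 fun t => (hPd t).continuousAt
  have hF : Continuous fun t => f t - P t := hf.sub hPc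
  have h1 : ∀ θ, IsTimeTest T θ → ∫ t in (0 : ℝ)..T, deriv θ t * (f t - P t) = 0 := by
    intro θ hθ
    have hp := intervalIntegral.integral_deriv_mul_eq_sub (a := 0) (b := T)
      (u := θ) (v := P) (u' := deriv θ) (v' := g)
      (fun x _ => (hθ.smooth.differentiable (by simp) x).hasDerivAt) (fun x _ => hPd x)
      (hθ.continuous_deriv.intervalIntegrable _ _) (hg.intervalIntegrable _ _)
    rw [hθ.apply_zero, hθ.apply_end] at hp
    have hd := hθ.continuous_deriv
    have hc := hθ.smooth.continuous
    have e : ∀ t, deriv θ t * (f t - P t) =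
        (deriv θ t * f t + θ t * g t) - (deriv θ t * P t + θ t * g t) := fun t => by ring
    simp_rw [e]
    rw [intervalIntegral_sub_of_continuous _ _ (p := fun t => deriv θ t * f t + θ t * g t)
      (q := fun t => deriv θ t * P t + θ t * g t) (by fun_prop) (by fun_prop), h θ hθ, hp]
    ring
  -- The du Bois-Reymond argument: for any test `θ`, the function `θ - (∫ θ) χ` has mean zero and is
  -- thus the derivative of a test function. So `f - P` must equal its average `c` against `χ`.
  obtain ⟨χ, hχ, hχ1⟩ := exists_isTimeTest hT
  set c := ∫ t in (0 : ℝ)..T, χ t * (f t - P t) with hc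
  have h2 := eq_zero_of_forall_integral_mul_eq_zero hT (φ := fun t => f t - P t - c)
    (hF.sub continuous_const) fun θ hθ => by
      set k := ∫ t in (0 : ℝ)..T, θ t with hk
      have cθ := hθ.smooth.continuous
      have cχ := hχ.smooth.continuous
      have hη := hθ.sub_const_mul hχ k
      have hη0 : ∫ t in (0 : ℝ)..T, (θ t - k * χ t) = 0 := by
        rw [intervalIntegral_sub_of_continuous _ _ (q := fun t => k * χ t) cθ (by fun_prop),
          intervalIntegral.integral_const_mul,
          hχ1, ← hk]
        ring
      obtain ⟨hp, hpd⟩ := hη.primitive hT hη0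
      have h3 := h1 _ hp
      rw [hpd] at h3
      have e : ∀ t, θ t * (f t - P t - c) =
          (θ t - k * χ t) * (f t - P t) + (k * (χ t * (f t - P t)) - c * θ t) := fun t => by ring
      simp_rw [e]
      rw [intervalIntegral_add_of_continuous _ _ (p := fun t => (θ t - k * χ t) * (f t - P t))
        (q := fun t => k * (χ t * (f t - P t)) - c * θ t) (by fun_prop) (by fun_prop),
        h3, intervalIntegral_sub_of_continuous _ _ (p := fun t => k * (χ t * (f t - P t)))
        (q := fun t => c * θ t) (by fun_prop) (by fun_prop), intervalIntegral.integral_const_mul,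
        intervalIntegral.integral_const_mul, ← hc, ← hk]
      ring
  have e1 := h2 t ht
  have e2 := h2 s hs
  have e3 : P s + ∫ r in s..t, g r = P t :=
    intervalIntegral.integral_add_adjacent_intervals (hg.intervalIntegrable _ _)
      (hg.intervalIntegrable _ _)
  linarith

/-- A symmetric form with continuous partial derivative, along the diagonal. -/
theorem diag_sub_eq_integral {T : ℝ} {Φ G : ℝ → ℝ → ℝ} (hsymm : ∀ a b, Φ a b = Φ b a)
    (hG : Continuous fun p : ℝ × ℝ => G p.1 p.2)
    (hΦ : ∀ a ∈ Icc 0 T, ∀ s ∈ Icc 0 T, ∀ t ∈ Icc 0 T, Φ a t - Φ a s = ∫ r in s..t, G a r)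
    {t : ℝ} (ht : t ∈ Icc 0 T) : Φ t t - Φ 0 0 = 2 * ∫ r in (0 : ℝ)..t, G r r := by
  have hGd : Continuous fun r => G r r := hG.comp (continuous_id.prodMk continuous_id)
  have hGa : ∀ a, Continuous fun r => G a r := fun a => hG.comp (continuous_const.prodMk continuous_id)
  have hd : ∀ s ∈ Icc 0 T, HasDerivWithinAt (fun t => Φ t t) (2 * G s s) (Icc 0 T) s := by
    intro s hs
    rw [hasDerivWithinAt_iff_isLittleO, Asymptotics.isLittleO_iff]
    intro c hc
    have hct := hG.continuousAt (x := (s, s))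
    rw [Metric.continuousAt_iff] at hct
    obtain ⟨δ, hδ, hδG⟩ := hct (c / 2) (by positivity)
    have hn : Metric.ball s δ ∩ Icc 0 T ∈ 𝓝[Icc 0 T] s :=
      inter_mem (mem_nhdsWithin_of_mem_nhds (Metric.ball_mem_nhds _ hδ)) self_mem_nhdsWithin
    filter_upwards [hn] with t ht
    -- By symmetry the diagonal increment is `Φ t t - Φ t s` plus `Φ s t - Φ s s`. Both vary only
    -- the second argument, so no differentiability in the first one is needed.
    have e : Φ t t - Φ s s - (t - s) • (2 * G s s) =
        ∫ r in s..t, ((G t r - G s s) + (G s r - G s s)) := by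
      have i1 := (hGa t).intervalIntegrable (μ := volume) s t
      have i2 := (hGa s).intervalIntegrable (μ := volume) s t
      have i0 := (continuous_const (y := G s s)).intervalIntegrable (μ := volume) s t
      rw [intervalIntegral.integral_add (i1.sub i0) (i2.sub i0),
        intervalIntegral.integral_sub i1 i0, intervalIntegral.integral_sub i2 i0,
        ← hΦ t ht.2 s hs t ht.2, ← hΦ s hs s hs t ht.2, intervalIntegral.integral_const,
        hsymm t s]
      simp only [smul_eq_mul]
      ring
    rw [e]
    have hts : |t - s| < δ := ht.1
    refine intervalIntegral.norm_integral_le_of_norm_le_const fun r hr => ?_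
    have hr' : |r - s| < δ := by
      refine lt_of_le_of_lt ?_ hts
      rcases mem_uIoc.1 hr with h | h
      · rw [abs_of_pos (by linarith [h.1]), abs_of_pos (by linarith [h.1, h.2])]; linarith [h.2]
      · rw [abs_of_nonpos (by linarith [h.2]), abs_of_neg (by linarith [h.1, h.2])]; linarith [h.1]
    have b1 := hδG (x := (t, r)) (by simp [Prod.dist_eq, Real.dist_eq, hts, hr'])
    have b2 := hδG (x := (s, r)) (by simp [Prod.dist_eq, Real.dist_eq, hr'])
    rw [Real.dist_eq] at b1 b2
    simp only at b1 b2
    refine (norm_add_le _ _).trans ?_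
    simp only [Real.norm_eq_abs]
    linarith
  have hI : ∀ s, HasDerivAt (fun t => 2 * ∫ r in (0 : ℝ)..t, G r r) (2 * G s s) s := fun s =>
    ((hGd.integral_hasStrictDerivAt 0 s).hasDerivAt).const_mul 2
  have h0 : (0 : ℝ) ∈ Icc 0 T := ⟨le_rfl, ht.1.trans ht.2⟩
  have := (convex_Icc (0 : ℝ) T).norm_image_sub_le_of_norm_hasDerivWithin_le (C := 0)
    (f := fun t => Φ t t - 2 * ∫ r in (0 : ℝ)..t, G r r)
    (fun s hs => (hd s hs).sub (hI s).hasDerivWithinAt) (fun s _ => by simp) h0 ht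
  rw [zero_mul, norm_le_zero_iff] at this
  simp only [intervalIntegral.integral_same, mul_zero, sub_zero] at this
  linarith

/-- Telescoping, changing one argument at a time. -/
theorem continuous_of_trilinear_bound {E X : Type*} [SeminormedAddCommGroup E] [TopologicalSpace X]
    {B : E → E → E → ℝ} {C : ℝ} (hC : ∀ x y z, |B x y z| ≤ C * ‖x‖ * ‖y‖ * ‖z‖)
    (h₁ : ∀ x x' y z, B (x - x') y z = B x y z - B x' y z)
    (h₂ : ∀ x y y' z, B x (y - y') z = B x y z - B x y' z)
    (h₃ : ∀ x y z z', B x y (z - z') = B x y z - B x y z')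
    {u v w : X → E} (hu : Continuous u) (hv : Continuous v) (hw : Continuous w) :
    Continuous fun p => B (u p) (v p) (w p) := by
  refine continuous_iff_continuousAt.2 fun p => tendsto_iff_norm_sub_tendsto_zero.2 ?_
  have hb : ∀ q, ‖B (u q) (v q) (w q) - B (u p) (v p) (w p)‖ ≤
      C * ‖u q - u p‖ * ‖v q‖ * ‖w q‖ + C * ‖u p‖ * ‖v q - v p‖ * ‖w q‖
        + C * ‖u p‖ * ‖v p‖ * ‖w q - w p‖ := fun q => by
    have e : B (u q) (v q) (w q) - B (u p) (v p) (w p) = B (u q - u p) (v q) (w q)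
        + B (u p) (v q - v p) (w q) + B (u p) (v p) (w q - w p) := by
      rw [h₁, h₂, h₃]; ring
    rw [e]
    exact (norm_add_le _ _).trans (add_le_add ((norm_add_le _ _).trans
      (add_le_add (hC _ _ _) (hC _ _ _))) (hC _ _ _))
  refine squeeze_zero (fun _ => norm_nonneg _) hb ?_
  have hct : Continuous fun q => C * ‖u q - u p‖ * ‖v q‖ * ‖w q‖ + C * ‖u p‖ * ‖v q - v p‖ * ‖w q‖
        + C * ‖u p‖ * ‖v p‖ * ‖w q - w p‖ := by fun_prop
  simpa using hct.tendsto p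

/-! ### Continuity of the nonlinear forms -/

theorem norm_sq_eq_integral (v : L2 d m) : ‖v‖ ^ 2 = ∫ x, ‖v x‖ ^ 2 := by
  rw [← real_inner_self_eq_norm_sq, L2.inner_def]
  simp_rw [real_inner_self_eq_norm_sq]

theorem integrable_norm_mul_norm (v w : L2 d m) : Integrable fun x => ‖v x‖ * ‖w x‖ :=
  (Lp.memLp v).norm.integrable_mul (Lp.memLp w).norm

theorem integral_norm_mul_norm_le (v w : L2 d m) : ∫ x, ‖v x‖ * ‖w x‖ ≤ ‖v‖ * ‖w‖ := by
  have h := integral_mul_norm_le_Lp_mul_Lq (μ := (volume : Measure (Torus d))) (p := 2) (q := 2)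
    (f := v) (g := w) (by rw [Real.holderConjugate_iff]; norm_num) (by simpa using Lp.memLp v)
    (by simpa using Lp.memLp w)
  have e : ∀ v : L2 d m, (∫ x, ‖v x‖ ^ (2 : ℝ)) ^ (1 / 2 : ℝ) = ‖v‖ := fun v => by
    simp_rw [Real.rpow_two]
    rw [← norm_sq_eq_integral, ← Real.sqrt_eq_rpow, Real.sqrt_sq (norm_nonneg _)]
  rwa [e, e] at h

theorem integrable_norm_L2 (v : L2 d m) : Integrable fun x => ‖v x‖ :=
  ((Lp.memLp v).integrable (by norm_num)).norm

theorem integral_norm_le (v : L2 d m) : ∫ x, ‖v x‖ ≤ ‖v‖ := by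
  have h := integral_mul_norm_le_Lp_mul_Lq (μ := (volume : Measure (Torus d))) (p := 2) (q := 2)
    (f := fun x => ‖v x‖) (g := fun _ => (1 : ℝ)) (by rw [Real.holderConjugate_iff]; norm_num)
    (by simpa using (Lp.memLp v).norm) (by simpa using memLp_const (1 : ℝ))
  simp only [norm_norm, norm_one, mul_one, Real.rpow_two, one_pow, integral_const, probReal_univ, smul_eq_mul,
    Real.one_rpow] at h
  rwa [← norm_sq_eq_integral, ← Real.sqrt_eq_rpow, Real.sqrt_sq (norm_nonneg _)] at h

theorem integral_abs_cf_le (v : L2 d m) (i : Fin 3) : ∫ x, |cf v i x| ≤ ‖v‖ :=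
  (integral_mono (integrable_cf v i).abs (integrable_norm_L2 v) fun _ => abs_comp_le _ _).trans
    (integral_norm_le v)

theorem cf_sub_ae (v w : L2 d m) (i : Fin 3) :
    cf (v - w) i =ᵐ[volume] fun x => cf v i x - cf w i x := by
  filter_upwards [Lp.coeFn_sub v w] with x hx
  simp only [cf, hx, Pi.sub_apply, comp_sub]

/-- Linear smoothing operators, bounded from `L²` to bounded functions. -/
structure IsSmoothing (A : L2 d m → Torus d → ℝ) : Prop where
  sm : ∀ v, Sm (A v)
  sub : ∀ v w x, A (v - w) x = A v x - A w x
  bound : ∃ C, 0 ≤ C ∧ ∀ v x, |A v x| ≤ C * ‖v‖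

theorem isSmoothing_conv {κ : Vec d → ℝ} (hκ : IsKer (1 / 2) κ) (i : Fin 3) :
    IsSmoothing fun v : L2 d m => conv κ (cf v i) where
  sm v := sm_conv hκ (integrable_cf v i)
  sub v w x := by
    rw [conv_congr_ae hκ (cf_sub_ae v w i), conv_sub hκ (integrable_cf v i) (integrable_cf w i)]
  bound := by
    obtain ⟨C, hC0, hC⟩ := hκ.exists_bound
    exact ⟨C, hC0, fun v x => (abs_conv_le hκ hC (integrable_cf v i) x).trans
      (mul_le_mul_of_nonneg_left (integral_abs_cf_le v i) hC0)⟩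

theorem IsSmoothing.conv {A : L2 d m → Torus d → ℝ} (hA : IsSmoothing A) {κ : Vec d → ℝ}
    (hκ : IsKer (1 / 2) κ) : IsSmoothing fun v => conv κ (A v) where
  sm v := sm_conv hκ (hA.sm v).integrable
  sub v w x := by
    rw [← conv_sub hκ (hA.sm v).integrable (hA.sm w).integrable]
    congr 1
    funext z; exact hA.sub v w z
  bound := by
    obtain ⟨C, hC0, hC⟩ := hκ.exists_bound
    obtain ⟨D, hD0, hD⟩ := hA.bound
    refine ⟨C * D, mul_nonneg hC0 hD0, fun v x =>
      (abs_conv_le hκ hC (hA.sm v).integrable x).trans ?_⟩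
    rw [mul_assoc]
    refine mul_le_mul_of_nonneg_left ?_ hC0
    refine (integral_mono (hA.sm v).integrable.abs (integrable_const (D * ‖v‖)) (hD v)).trans ?_
    simp

theorem IsSmoothing.fun_sub {A B : L2 d m → Torus d → ℝ} (hA : IsSmoothing A) (hB : IsSmoothing B) :
    IsSmoothing fun v x => A v x - B v x where
  sm v := (hA.sm v).sub (hB.sm v)
  sub v w x := by rw [hA.sub, hB.sub]; ring
  bound := by
    obtain ⟨C, hC0, hC⟩ := hA.bound
    obtain ⟨D, hD0, hD⟩ := hB.bound
    refine ⟨C + D, by positivity, fun v x => ?_⟩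
    have h1 := hC v x
    have h2 := hD v x
    have h3 := abs_sub (A v x) (B v x)
    linarith

theorem integrable_continuous_mul {b : Torus d → ℝ} (hb : Continuous b) {f : Torus d → ℝ}
    (hf : Integrable f) : Integrable fun x => b x * f x := by
  obtain ⟨C, -, hC⟩ := exists_bound_of_continuous hb
  exact hf.bdd_mul hb.aestronglyMeasurable (ae_of_all _ hC)

theorem abs_integral_mul_cf_mul_cf_le {b : Torus d → ℝ} {C : ℝ} (hC : ∀ x, |b x| ≤ C)
    (v w : L2 d m) (i j : Fin 3) :
    |∫ x, b x * (cf v i x * cf w j x)| ≤ C * ‖v‖ * ‖w‖ := by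
  have hC0 : 0 ≤ C := (abs_nonneg _).trans (hC 0)
  have h1 : ∀ x, ‖b x * (cf v i x * cf w j x)‖ ≤ C * (‖v x‖ * ‖w x‖) := fun x => by
    rw [norm_mul, norm_mul, Real.norm_eq_abs, Real.norm_eq_abs, Real.norm_eq_abs]
    have h1 := abs_comp_le (v x) i
    have h2 := abs_comp_le (w x) j
    unfold cf
    gcongr
    exact hC x
  refine (norm_integral_le_of_norm_le ((integrable_norm_mul_norm v w).const_mul C)
    (ae_of_all _ h1)).trans ?_
  rw [integral_const_mul, mul_assoc]
  exact mul_le_mul_of_nonneg_left (integral_norm_mul_norm_le v w) hC0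

/-- A product of two square-integrable components is merely integrable, so the first factor must be
bounded by the `L²` norm of its field. Joint continuity in all three fields is what
`diag_sub_eq_integral` needs, with the test field frozen at one time and the solution taken at
another. -/
theorem IsSmoothing.continuous_integral {A : L2 d m → Torus d → ℝ} (hA : IsSmoothing A)
    {X : Type*} [TopologicalSpace X] {u v w : X → L2 d m} (hu : Continuous u) (hv : Continuous v)
    (hw : Continuous w) (i j : Fin 3) :
    Continuous fun p => ∫ x, A (u p) x * (cf (v p) i x * cf (w p) j x) := by
  obtain ⟨C, hC0, hC⟩ := hA.bound
  have hi : ∀ a b c : L2 d m, Integrable fun x => A a x * (cf b i x * cf c j x) := fun a b c =>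
    integrable_continuous_mul (hA.sm a).continuous (integrable_cf_mul b c i j)
  refine continuous_of_trilinear_bound (B := fun a b c => ∫ x, A a x * (cf b i x * cf c j x))
    (C := C) (fun a b c => abs_integral_mul_cf_mul_cf_le (hC a) b c i j) (fun a a' b c => ?_)
    (fun a b b' c => ?_) (fun a b c c' => ?_) hu hv hw
  · rw [← integral_sub (hi _ _ _) (hi _ _ _)]
    exact integral_congr_ae (ae_of_all _ fun x => by simp only [hA.sub]; ring)
  · rw [← integral_sub (hi _ _ _) (hi _ _ _)]
    refine integral_congr_ae ?_
    filter_upwards [cf_sub_ae b b' i] with x hx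
    rw [hx]; ring
  · rw [← integral_sub (hi _ _ _) (hi _ _ _)]
    refine integral_congr_ae ?_
    filter_upwards [cf_sub_ae c c' j] with x hx
    rw [hx]; ring

theorem continuous_integral_mul_cf {b : Torus d → ℝ} (hb : Continuous b) {v : ℝ → L2 d m}
    (hv : Continuous v) (i : Fin 3) : Continuous fun t => ∫ x, b x * cf (v t) i x := by
  obtain ⟨C, hC0, hC⟩ := exists_bound_of_continuous hb
  have hi : ∀ v : L2 d m, Integrable fun x => b x * cf v i x := fun v =>
    integrable_continuous_mul hb (integrable_cf v i)
  refine continuous_iff_continuousAt.2 fun s => tendsto_iff_norm_sub_tendsto_zero.2 ?_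
  have h1 : ∀ t, ‖(∫ x, b x * cf (v t) i x) - ∫ x, b x * cf (v s) i x‖ ≤ C * ‖v t - v s‖ := by
    intro t
    have e : (∫ x, b x * cf (v t) i x) - ∫ x, b x * cf (v s) i x =
        ∫ x, b x * cf (v t - v s) i x := by
      rw [← integral_sub (hi _) (hi _)]
      refine integral_congr_ae ?_
      filter_upwards [cf_sub_ae (v t) (v s) i] with x hx
      rw [hx]; ring
    rw [e]
    refine (norm_integral_le_of_norm_le ((integrable_cf (v t - v s) i).abs.const_mul C)
      (ae_of_all _ fun x => ?_)).trans ?_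
    · rw [norm_mul]
      exact mul_le_mul_of_nonneg_right (hC x) (norm_nonneg _)
    · rw [integral_const_mul]
      exact mul_le_mul_of_nonneg_left (integral_abs_cf_le _ i) hC0
  refine squeeze_zero (fun _ => norm_nonneg _) h1 ?_
  have : Continuous fun t => C * ‖v t - v s‖ := by fun_prop
  simpa using this.tendsto s

/-! ### The mollified weak formulation -/

/-- The components of the doubly mollified field. -/
def moll (κ : Vec d → ℝ) (v : L2 d m) (i : Fin 3) : Torus d → ℝ := conv κ (conv κ (cf v i))

theorem sm_moll {κ : Vec d → ℝ} (hκ : IsKer (1 / 2) κ) (v : L2 d m) (i : Fin 3) :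
    Sm (moll κ v i) := sm_conv hκ (sm_conv hκ (integrable_cf v i)).integrable

theorem pderiv_moll {κ : Vec d → ℝ} (hκ : IsKer (1 / 2) κ) (v : L2 d m) (i j : Fin 3) :
    pderiv j (moll κ v i) = conv κ (conv (dker j κ) (cf v i)) :=
  pderiv_conv_conv hκ hκ (integrable_cf v i) (measurable_cf v i) j

theorem pderiv_curlC_moll {κ : Vec d → ℝ} (hκ : IsKer (1 / 2) κ) (v : L2 d m) (i j : Fin 3)
    (x : Torus d) : pderiv j (curlC (moll κ v) i) x =
      conv κ (conv (dker j (dker (i + 1) κ)) (cf v (i + 2))) x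
        - conv κ (conv (dker j (dker (i + 2) κ)) (cf v (i + 1))) x := by
  unfold curlC
  rw [pderiv_sub ((sm_moll hκ v _).pderiv _) ((sm_moll hκ v _).pderiv _), pderiv_moll hκ,
    pderiv_moll hκ, pderiv_conv_conv hκ (hκ.dker _) (integrable_cf v _) (measurable_cf v _),
    pderiv_conv_conv hκ (hκ.dker _) (integrable_cf v _) (measurable_cf v _)]

/-- The outer mollification factors out of the second derivatives, so it can be transferred to the
quadratic terms in `form_add_form_eq_flux`. -/
theorem pderiv_curlC_moll_eq_conv {κ : Vec d → ℝ} (hκ : IsKer (1 / 2) κ) (v : L2 d m)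
    (i j : Fin 3) : pderiv j (curlC (moll κ v) i) =
      conv κ (pderiv j (curlC (fun k => conv κ (cf v k)) i)) := by
  funext x
  have hs := fun k => sm_conv hκ (integrable_cf v k)
  have e : pderiv j (curlC (fun k => conv κ (cf v k)) i) = fun x =>
      conv (dker j (dker (i + 1) κ)) (cf v (i + 2)) x
        - conv (dker j (dker (i + 2) κ)) (cf v (i + 1)) x := by
    funext x
    unfold curlC
    rw [pderiv_sub ((hs _).pderiv _) ((hs _).pderiv _), pderiv_conv hκ (integrable_cf v _),
      pderiv_conv hκ (integrable_cf v _), pderiv_conv (hκ.dker _) (integrable_cf v _),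
      pderiv_conv (hκ.dker _) (integrable_cf v _)]
  rw [pderiv_curlC_moll hκ, e, conv_sub hκ
    (sm_conv ((hκ.dker _).dker j) (integrable_cf v _)).integrable
    (sm_conv ((hκ.dker _).dker j) (integrable_cf v _)).integrable]

theorem isSmoothing_pderiv_moll {κ : Vec d → ℝ} (hκ : IsKer (1 / 2) κ) (i j : Fin 3) :
    IsSmoothing fun v : L2 d m => pderiv j (moll κ v i) := by
  simp_rw [pderiv_moll hκ]
  exact (isSmoothing_conv (hκ.dker j) i).conv hκ

theorem isSmoothing_pderiv_curlC_moll {κ : Vec d → ℝ} (hκ : IsKer (1 / 2) κ) (i j : Fin 3) :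
    IsSmoothing fun v : L2 d m => pderiv j (curlC (moll κ v) i) := by
  have : (fun v : L2 d m => pderiv j (curlC (moll κ v) i)) = fun v x =>
      conv κ (conv (dker j (dker (i + 1) κ)) (cf v (i + 2))) x
        - conv κ (conv (dker j (dker (i + 2) κ)) (cf v (i + 1))) x := by
    funext v x; exact pderiv_curlC_moll hκ v i j x
  rw [this]
  exact ((isSmoothing_conv ((hκ.dker _).dker j) _).conv hκ).fun_sub
    ((isSmoothing_conv ((hκ.dker _).dker j) _).conv hκ)

/-- The mollified `L²` pairing. -/
def pairing (κ : Vec d → ℝ) (w v : L2 d m) : ℝ := ∑ i : Fin 3, ∫ x, moll κ w i x * cf v i x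

/-- The momentum form tested with a mollified field. -/
def momentumForm (κ : Vec d → ℝ) (w u h : L2 d m) : ℝ :=
  ∑ i : Fin 3, ∑ j : Fin 3,
    ∫ x, pderiv j (moll κ w i) x * (cf u i x * cf u j x - cf h i x * cf h j x)

/-- The induction form tested with a mollified field. -/
def inductionForm (κ : Vec d → ℝ) (w u h : L2 d m) : ℝ :=
  ∑ i : Fin 3, ∑ j : Fin 3,
    ((∫ x, pderiv j (moll κ w i) x * (cf h i x * cf u j x - cf u i x * cf h j x))
      + ∫ x, pderiv j (curlC (moll κ w) i) x * (cf h i x * cf h j x))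

theorem IsSmoothing.continuous_integral_sub {A : L2 d m → Torus d → ℝ} (hA : IsSmoothing A)
    {X : Type*} [TopologicalSpace X] {u v w v' w' : X → L2 d m} (hu : Continuous u)
    (hv : Continuous v) (hw : Continuous w) (hv' : Continuous v') (hw' : Continuous w')
    (i j : Fin 3) : Continuous fun p =>
      ∫ x, A (u p) x * (cf (v p) i x * cf (w p) j x - cf (v' p) i x * cf (w' p) j x) := by
  have : ∀ p, ∫ x, A (u p) x * (cf (v p) i x * cf (w p) j x - cf (v' p) i x * cf (w' p) j x) =
      (∫ x, A (u p) x * (cf (v p) i x * cf (w p) j x))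
        - ∫ x, A (u p) x * (cf (v' p) i x * cf (w' p) j x) := fun p => by
    simp_rw [mul_sub]
    exact integral_sub
      (integrable_continuous_mul (hA.sm _).continuous (integrable_cf_mul _ _ i j))
      (integrable_continuous_mul (hA.sm _).continuous (integrable_cf_mul _ _ i j))
  simp_rw [this]
  exact (hA.continuous_integral hu hv hw i j).sub (hA.continuous_integral hu hv' hw' i j)

theorem continuous_momentumForm {κ : Vec d → ℝ} (hκ : IsKer (1 / 2) κ) {X : Type*}
    [TopologicalSpace X] {w u h : X → L2 d m} (hw : Continuous w) (hu : Continuous u)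
    (hh : Continuous h) : Continuous fun p => momentumForm κ (w p) (u p) (h p) :=
  continuous_finsetSum _ fun i _ => continuous_finsetSum _ fun j _ =>
    (isSmoothing_pderiv_moll hκ i j).continuous_integral_sub hw hu hu hh hh i j

theorem continuous_inductionForm {κ : Vec d → ℝ} (hκ : IsKer (1 / 2) κ) {X : Type*}
    [TopologicalSpace X] {w u h : X → L2 d m} (hw : Continuous w) (hu : Continuous u)
    (hh : Continuous h) : Continuous fun p => inductionForm κ (w p) (u p) (h p) :=
  continuous_finsetSum _ fun i _ => continuous_finsetSum _ fun j _ =>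
    ((isSmoothing_pderiv_moll hκ i j).continuous_integral_sub hw hh hu hu hh i j).add
      ((isSmoothing_pderiv_curlC_moll hκ i j).continuous_integral hw hh hh i j)

theorem integral_conv_mul_eq_of_even {κ : Vec d → ℝ} (hκ : IsKer (1 / 2) κ)
    (he : ∀ y, κ (-y) = κ y) {f g : Torus d → ℝ} (hf : Continuous f) (hg : Measurable g)
    (hgi : Integrable g) : ∫ x, conv κ f x * g x = ∫ x, f x * conv κ g x := by
  have h := integral_conv_mul_eq hκ hg hgi hf
  rw [funext he] at h
  simp_rw [mul_comm (f _)]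
  rw [h]
  simp_rw [mul_comm (g _)]

/-- Moving one of the two mollifications across by evenness makes the pairing visibly symmetric, and
on the diagonal a sum of squares. -/
theorem pairing_comm {κ : Vec d → ℝ} (hκ : IsKer (1 / 2) κ) (he : ∀ y, κ (-y) = κ y)
    (v w : L2 d m) : pairing κ v w = ∑ i : Fin 3, ∫ x, conv κ (cf v i) x * conv κ (cf w i) x :=
  Finset.sum_congr rfl fun i _ => integral_conv_mul_eq_of_even hκ he
    (sm_conv hκ (integrable_cf v i)).continuous (measurable_cf w i) (integrable_cf w i)

/-- This is why the test field is mollified twice: one mollification stays on the test field, the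
other passes by self-adjointness to the quadratic terms. -/
theorem form_add_form_eq_flux {κ : Vec d → ℝ} (hκ : IsKer (1 / 2) κ) (he : ∀ y, κ (-y) = κ y)
    (u h : L2 d m) :
    momentumForm κ u u h + inductionForm κ h u h = flux κ (cf u) (cf h) := by
  have e1 : ∀ (v : L2 d m) (i j : Fin 3) (P : Torus d → ℝ), Measurable P → Integrable P →
      ∫ x, pderiv j (moll κ v i) x * P x = ∫ x, pderiv j (conv κ (cf v i)) x * conv κ P x := by
    intro v i j P hP hPi
    rw [pderiv_moll hκ, ← pderiv_conv hκ (integrable_cf v i)]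
    exact integral_conv_mul_eq_of_even hκ he ((sm_conv hκ (integrable_cf v i)).pderiv j).continuous
      hP hPi
  have e2 : ∀ (v : L2 d m) (i j : Fin 3) (P : Torus d → ℝ), Measurable P → Integrable P →
      ∫ x, pderiv j (curlC (moll κ v) i) x * P x =
        ∫ x, pderiv j (curlC (fun k => conv κ (cf v k)) i) x * conv κ P x := by
    intro v i j P hP hPi
    rw [pderiv_curlC_moll_eq_conv hκ]
    exact integral_conv_mul_eq_of_even hκ he
      ((sm_curlC (fun k => sm_conv hκ (integrable_cf v k)) i).pderiv j).continuous hP hPi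
  have hm : ∀ (v w : L2 d m) (i j : Fin 3), Measurable fun x => cf v i x * cf w j x :=
    fun v w i j => (measurable_cf v i).mul (measurable_cf w j)
  have hi := fun (v w : L2 d m) (i j : Fin 3) => integrable_cf_mul v w i j
  unfold momentumForm inductionForm flux
  rw [← Finset.sum_add_distrib]
  refine Finset.sum_congr rfl fun i _ => ?_
  rw [← Finset.sum_add_distrib]
  refine Finset.sum_congr rfl fun j _ => ?_
  rw [e1 u i j (fun x => cf u i x * cf u j x - cf h i x * cf h j x)
      ((hm u u i j).sub (hm h h i j)) ((hi u u i j).sub (hi h h i j)),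
    e1 h i j (fun x => cf h i x * cf u j x - cf u i x * cf h j x)
      ((hm h u i j).sub (hm u h i j)) ((hi h u i j).sub (hi u h i j)),
    e2 h i j _ (hm h h i j) (hi h h i j), add_assoc]

/-- The doubly mollified field. -/
def mollField (κ : Vec d → ℝ) (w : L2 d m) (x : Torus d) : Vec m :=
  WithLp.toLp 2 fun i : Fin m => if hi : i.1 < 3 then moll κ w ⟨i.1, hi⟩ x else 0

theorem comp_mollField {κ : Vec d → ℝ} (w : L2 d m) (x : Torus d) (i : Fin 3) :
    comp (mollField κ w x) i = moll κ w i x := by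
  unfold comp mollField
  split_ifs with hi
  · simp
  · have : cf w i = fun _ => 0 := by funext z; simp [cf, comp, hi]
    simp [moll, this, conv_zero]

theorem sum_pderiv_moll {κ : Vec d → ℝ} (hκ : IsKer (1 / 2) κ) (he : ∀ y, κ (-y) = κ y)
    {w : L2 d m} (hw : WDivFree w) (x : Torus d) : ∑ i : Fin 3, pderiv i (moll κ w i) x = 0 := by
  have h := sum_pderiv_conv_eq_zero hκ he (measurable_cf w) (integrable_cf w) hw
  have hs := fun i => sm_conv (hκ.dker i) (integrable_cf w i)
  simp_rw [pderiv_conv hκ (integrable_cf w _), Fin.sum_univ_three] at h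
  simp_rw [pderiv_moll hκ, Fin.sum_univ_three]
  rw [← conv_add hκ (hs 0).integrable (hs 1).integrable,
    ← conv_add hκ ((hs 0).add (hs 1)).integrable (hs 2).integrable]
  simp_rw [h]
  rw [conv_zero]

/-- The field `w` does not depend on time, so smoothness and compact support in time rest on `θ`
alone. -/
theorem isTestField_smul {T : ℝ} {θ : ℝ → ℝ} (hθ : IsTimeTest T θ) {κ : Vec d → ℝ}
    (hκ : IsKer (1 / 2) κ) (he : ∀ y, κ (-y) = κ y) {w : L2 d m} (hw : WDivFree w) :
    IsTestField T fun t x => θ t • mollField κ w x := by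
  have hs : tsupport (fun p : ℝ × Torus d => θ p.1 • mollField κ w p.2) ⊆ tsupport θ ×ˢ univ := by
    refine closure_minimal (fun p hp => ⟨subset_tsupport _ fun h => hp ?_, mem_univ _⟩)
      ((isClosed_tsupport θ).prod isClosed_univ)
    simp [h]
  refine ⟨?_, (hθ.compact.isCompact.prod isCompact_univ).of_isClosed_subset
    (isClosed_tsupport _) hs, hs.trans (prod_mono hθ.support subset_rfl), fun t x => ?_⟩
  · refine ContDiff.smul (hθ.smooth.comp contDiff_fst) ?_
    refine ContDiff.comp (g := fun X : Vec d => mollField κ w (toTorus X)) ?_ contDiff_snd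
    refine contDiff_euclidean.2 fun i => ?_
    unfold mollField
    by_cases hi : i.1 < 3
    · simp only [hi, dite_true]
      exact sm_moll hκ w _
    · simp only [hi, dite_false]
      exact contDiff_const
  · unfold divergence
    have : ∀ i, (fun z => comp (θ t • mollField κ w z) i) = fun z => θ t * moll κ w i z := fun i => by
      funext z
      rw [← compCLM_apply, map_smul, compCLM_apply, comp_mollField, smul_eq_mul]
    simp_rw [this, pderiv_const_mul, ← Finset.mul_sum, sum_pderiv_moll hκ he hw, mul_zero]

/-! ### Weak solutions tested with mollified fields -/

/-- Testing with `θ(t)ψ(x)` and using continuity in time gives the constraint at every time, so the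
field at any frozen time may serve as a test field. -/
theorem IsDivFree.wDivFree {T : ℝ} (hT : 0 < T) {v : ℝ → L2 d m} (hv : Continuous v)
    (h : IsDivFree T v) {t : ℝ} (ht : t ∈ Icc 0 T) : WDivFree (v t) := by
  intro ψ hψ
  have hi : ∀ t j, Integrable fun x => cf (v t) j x * pderiv j ψ x := fun t j => by
    simp_rw [mul_comm (cf _ _ _)]
    exact integrable_continuous_mul (hψ.pderiv j).continuous (integrable_cf _ _)
  have hc : Continuous fun t => ∫ x, ∑ j : Fin 3, cf (v t) j x * pderiv j ψ x := by
    simp_rw [integral_finsetSum _ fun j _ => hi _ j, mul_comm (cf _ _ _)]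
    exact continuous_finsetSum _ fun j _ =>
      continuous_integral_mul_cf (hψ.pderiv j).continuous hv j
  refine eq_zero_of_forall_integral_mul_eq_zero hT hc (fun θ hθ => ?_) t ht
  have := h (fun t x => θ t * ψ x) ((hθ.smooth.comp contDiff_fst).mul
    (ContDiff.comp (g := fun X : Vec d => ψ (toTorus X)) hψ contDiff_snd))
  refine Eq.trans ?_ this
  apply intervalIntegral.integral_congr
  intro t _
  simp only
  rw [← integral_const_mul]
  refine integral_congr_ae (ae_of_all _ fun x => ?_)
  simp only [pderiv_const_mul, Finset.mul_sum]
  exact Finset.sum_congr rfl fun j _ => by unfold cf; ring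

theorem comp_smul_mollField {κ : Vec d → ℝ} (c : ℝ) (w : L2 d m) (x : Torus d) (i : Fin 3) :
    comp (c • mollField κ w x) i = c * moll κ w i x := by
  rw [← compCLM_apply, map_smul, compCLM_apply, comp_mollField, smul_eq_mul]

theorem continuous_pairing {κ : Vec d → ℝ} (hκ : IsKer (1 / 2) κ) (w : L2 d m) {v : ℝ → L2 d m}
    (hv : Continuous v) : Continuous fun t => pairing κ w (v t) :=
  continuous_finsetSum _ fun i _ => continuous_integral_mul_cf (sm_moll hκ w i).continuous hv i

/-- The weak equation with `θ` times a mollified frozen field says that the pairing has the momentum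
form as distributional derivative. Both are continuous, so this integrates to an identity between
any two times. -/
theorem IsWeakSolution.pairing_sub_momentum {T : ℝ} (hT : 0 < T) {u h : ℝ → L2 d m}
    (hsol : IsWeakSolution T u h) (hu : Continuous u) (hh : Continuous h) {κ : Vec d → ℝ}
    (hκ : IsKer (1 / 2) κ) (he : ∀ y, κ (-y) = κ y) {w : L2 d m} (hw : WDivFree w)
    {s t : ℝ} (hs : s ∈ Icc 0 T) (ht : t ∈ Icc 0 T) :
    pairing κ w (u t) - pairing κ w (u s) = ∫ r in s..t, momentumForm κ w (u r) (h r) := by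
  refine sub_eq_integral_of_forall_test hT (continuous_pairing hκ w hu)
    (continuous_momentumForm hκ continuous_const hu hh) (fun θ hθ => ?_) hs ht
  refine Eq.trans ?_ (hsol.momentum _ (isTestField_smul hθ hκ he hw))
  apply intervalIntegral.integral_congr
  intro t _
  have i1 : ∀ i, Integrable fun x => deriv θ t * (moll κ w i x * cf (u t) i x) := fun i =>
    (integrable_continuous_mul (sm_moll hκ w i).continuous (integrable_cf _ _)).const_mul _
  have i2 : ∀ i j, Integrable fun x => θ t * (pderiv j (moll κ w i) x *
      (cf (u t) i x * cf (u t) j x - cf (h t) i x * cf (h t) j x)) := fun i j =>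
    (integrable_continuous_mul ((sm_moll hκ w i).pderiv j).continuous
      ((integrable_cf_mul _ _ i j).sub (integrable_cf_mul _ _ i j))).const_mul _
  have e : ∀ x, ((∑ i : Fin 3, deriv (fun s => comp (θ s • mollField κ w x) i) t * comp (u t x) i)
        + ∑ i : Fin 3, ∑ j : Fin 3, pderiv j (fun z => comp (θ t • mollField κ w z) i) x *
            (comp (u t x) i * comp (u t x) j - comp (h t x) i * comp (h t x) j)) =
      (∑ i : Fin 3, deriv θ t * (moll κ w i x * cf (u t) i x))
        + ∑ i : Fin 3, ∑ j : Fin 3, θ t * (pderiv j (moll κ w i) x *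
          (cf (u t) i x * cf (u t) j x - cf (h t) i x * cf (h t) j x)) := fun x => by
    simp only [comp_smul_mollField, pderiv_const_mul, deriv_mul_const_field, mul_assoc, cf]
  simp only
  simp_rw [e]
  rw [integral_add (integrable_finsetSum _ fun i _ => i1 i)
      (integrable_finsetSum _ fun i _ => integrable_finsetSum _ fun j _ => i2 i j),
    integral_finsetSum _ fun i _ => i1 i,
    integral_finsetSum _ fun i _ => integrable_finsetSum _ fun j _ => i2 i j]
  simp_rw [integral_finsetSum _ fun j _ => i2 _ j, integral_const_mul, ← Finset.mul_sum]
  rfl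

theorem IsWeakSolution.pairing_sub_induction {T : ℝ} (hT : 0 < T) {u h : ℝ → L2 d m}
    (hsol : IsWeakSolution T u h) (hu : Continuous u) (hh : Continuous h) {κ : Vec d → ℝ}
    (hκ : IsKer (1 / 2) κ) (he : ∀ y, κ (-y) = κ y) {w : L2 d m} (hw : WDivFree w)
    {s t : ℝ} (hs : s ∈ Icc 0 T) (ht : t ∈ Icc 0 T) :
    pairing κ w (h t) - pairing κ w (h s) = ∫ r in s..t, inductionForm κ w (u r) (h r) := by
  refine sub_eq_integral_of_forall_test hT (continuous_pairing hκ w hh)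
    (continuous_inductionForm hκ continuous_const hu hh) (fun θ hθ => ?_) hs ht
  refine Eq.trans ?_ (hsol.induction _ (isTestField_smul hθ hκ he hw))
  apply intervalIntegral.integral_congr
  intro t _
  have i1 : ∀ i, Integrable fun x => deriv θ t * (moll κ w i x * cf (h t) i x) := fun i =>
    (integrable_continuous_mul (sm_moll hκ w i).continuous (integrable_cf _ _)).const_mul _
  have i2 : ∀ i j, Integrable fun x => θ t * (pderiv j (moll κ w i) x *
      (cf (h t) i x * cf (u t) j x - cf (u t) i x * cf (h t) j x)) := fun i j =>
    (integrable_continuous_mul ((sm_moll hκ w i).pderiv j).continuous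
      ((integrable_cf_mul _ _ i j).sub (integrable_cf_mul _ _ i j))).const_mul _
  have i3 : ∀ i j, Integrable fun x => θ t * (pderiv j (curlC (moll κ w) i) x *
      (cf (h t) i x * cf (h t) j x)) := fun i j =>
    (integrable_continuous_mul ((sm_curlC (sm_moll hκ w) i).pderiv j).continuous
      (integrable_cf_mul _ _ i j)).const_mul _
  have ec : ∀ i, curl (fun x => θ t • mollField κ w x) i = fun x => θ t * curlC (moll κ w) i x := by
    intro i; funext x
    simp only [curl, curlC, comp_smul_mollField, pderiv_const_mul, mul_sub]
  have e : ∀ x, ((∑ i : Fin 3, deriv (fun s => comp (θ s • mollField κ w x) i) t * comp (h t x) i)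
        + (∑ i : Fin 3, ∑ j : Fin 3, pderiv j (fun z => comp (θ t • mollField κ w z) i) x *
            (comp (h t x) i * comp (u t x) j - comp (u t x) i * comp (h t x) j))
        + ∑ i : Fin 3, ∑ j : Fin 3, comp (h t x) i * comp (h t x) j *
            pderiv j (curl (fun x => θ t • mollField κ w x) i) x) =
      (∑ i : Fin 3, deriv θ t * (moll κ w i x * cf (h t) i x))
        + ∑ i : Fin 3, ∑ j : Fin 3, (θ t * (pderiv j (moll κ w i) x *
          (cf (h t) i x * cf (u t) j x - cf (u t) i x * cf (h t) j x))
          + θ t * (pderiv j (curlC (moll κ w) i) x * (cf (h t) i x * cf (h t) j x))) := fun x => by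
    simp only [comp_smul_mollField, pderiv_const_mul, deriv_mul_const_field, mul_assoc, cf, ec,
      Finset.sum_add_distrib, ← add_assoc]
    congr 1
    exact Finset.sum_congr rfl fun i _ => Finset.sum_congr rfl fun j _ => by ring
  simp only
  simp_rw [e]
  have i4 := fun i j => (i2 i j).add (i3 i j)
  simp only [Pi.add_def] at i4
  rw [integral_add (integrable_finsetSum _ fun i _ => i1 i)
      (integrable_finsetSum _ fun i _ => integrable_finsetSum _ fun j _ => i4 i j),
    integral_finsetSum _ fun i _ => i1 i,
    integral_finsetSum _ fun i _ => integrable_finsetSum _ fun j _ => i4 i j]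
  simp_rw [integral_finsetSum _ fun j _ => i4 _ j, integral_add (i2 _ _) (i3 _ _),
    integral_const_mul, ← mul_add, ← Finset.mul_sum]
  rfl

/-- The balance of the mollified energy. -/
theorem IsWeakSolution.mollified_energy_sub {T : ℝ} (hT : 0 < T) {u h : ℝ → L2 d m}
    (hsol : IsWeakSolution T u h) (hu : Continuous u) (hh : Continuous h) {κ : Vec d → ℝ}
    (hκ : IsKer (1 / 2) κ) (he : ∀ y, κ (-y) = κ y) {t : ℝ} (ht : t ∈ Icc 0 T) :
    (pairing κ (u t) (u t) + pairing κ (h t) (h t))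
      - (pairing κ (u 0) (u 0) + pairing κ (h 0) (h 0)) =
    2 * ∫ r in (0 : ℝ)..t, flux κ (cf (u r)) (cf (h r)) := by
  -- The first variable is the time at which the test fields are frozen, the second the time of the
  -- solution; the energy sits on the diagonal.
  have hd := diag_sub_eq_integral (T := T)
    (Φ := fun a b => pairing κ (u a) (u b) + pairing κ (h a) (h b))
    (G := fun a r => momentumForm κ (u a) (u r) (h r) + inductionForm κ (h a) (u r) (h r))
    (fun a b => by
      simp only [pairing_comm hκ he]
      congr 1 <;> exact Finset.sum_congr rfl fun i _ => by simp_rw [mul_comm])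
    ((continuous_momentumForm hκ (hu.comp continuous_fst) (hu.comp continuous_snd)
      (hh.comp continuous_snd)).add (continuous_inductionForm hκ (hh.comp continuous_fst)
      (hu.comp continuous_snd) (hh.comp continuous_snd)))
    (fun a ha s hs t ht => by
      rw [intervalIntegral_add_of_continuous _ _
        (continuous_momentumForm hκ continuous_const hu hh)
        (continuous_inductionForm hκ continuous_const hu hh),
        ← hsol.pairing_sub_momentum hT hu hh hκ he (hsol.divFree_u.wDivFree hT hu ha) hs ht,
        ← hsol.pairing_sub_induction hT hu hh hκ he (hsol.divFree_h.wDivFree hT hh ha) hs ht]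
      ring) ht
  simp only [form_add_form_eq_flux hκ he] at hd
  exact hd

/-! ### Convergence of the mollified energy -/

theorem integral_shift_sq (f : Torus d → ℝ) (y : Torus d) :
    ∫ x, f (x - y) ^ 2 = ∫ x, f x ^ 2 :=
  integral_sub_right_eq_self (fun x => f x ^ 2) y

/-- Strong continuity of translations on `L²`, paired with `f`. -/
theorem tendsto_integral_shift_mul {f : Torus d → ℝ} (hf : MemLp f 2) :
    Tendsto (fun y : Torus d => ∫ x, f (x - y) * f x) (𝓝 0) (𝓝 (∫ x, f x ^ 2)) := by
  have hmp : ∀ y : Torus d, MeasurePreserving (fun x => x - y) volume volume := fun y =>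
    measurePreserving_sub_right volume y
  let g : C(Torus d × Torus d, Torus d) := ⟨fun p => p.2 - p.1, by fun_prop⟩
  have hc := (continuous_const (y := hf.toLp f)).compMeasurePreservingLp g.curry.continuous
    (fun y => hmp y) (by norm_num : (2 : ENNReal) ≠ ⊤)
  have hI : ∀ y, ∫ x, f (x - y) * f x =
      inner ℝ (hf.toLp f) (Lp.compMeasurePreserving (g.curry y) (hmp y) (hf.toLp f)) := fun y => by
    rw [L2.inner_def]
    refine integral_congr_ae ?_
    have h1 := Lp.coeFn_compMeasurePreserving (hf.toLp f) (hmp y)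
    have h2 := (hmp y).quasiMeasurePreserving.ae hf.coeFn_toLp
    filter_upwards [h1, h2, hf.coeFn_toLp] with x e1 e2 e3
    have e1' : (Lp.compMeasurePreserving (g.curry y) (hmp y) (hf.toLp f)) x =
      (hf.toLp f) (x - y) := e1
    rw [e1', e2, e3]
    simp
  have ht : Continuous fun y : Torus d => ∫ x, f (x - y) * f x := by
    simp_rw [hI]
    exact continuous_const.inner hc
  simpa [sq] using ht.tendsto 0

theorem integrable_shift_mul {f g : Torus d → ℝ} (hf : MemLp f 2) (hg : MemLp g 2) (y : Torus d) :
    Integrable fun x => f (x - y) * g x :=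
  (hf.comp_measurePreserving (measurePreserving_sub_right volume y)).integrable_mul hg

theorem integral_norm_shift_mul_le {f g : Torus d → ℝ} (hf : MemLp f 2) (hg : MemLp g 2)
    (y : Torus d) :
    ∫ x, ‖f (x - y) * g x‖ ≤ ((∫ x, f x ^ 2) + ∫ x, g x ^ 2) / 2 := by
  have h1 : Integrable fun x => f (x - y) ^ 2 :=
    (hf.comp_measurePreserving (measurePreserving_sub_right volume y)).integrable_sq
  rw [← integral_shift_sq f y, ← integral_add h1 hg.integrable_sq, ← integral_div]
  refine integral_mono (integrable_shift_mul hf hg y).norm ((h1.add hg.integrable_sq).div_const 2)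
    fun x => ?_
  simp only [Real.norm_eq_abs, abs_mul]
  have := two_mul_le_add_sq |f (x - y)| |g x|
  rw [sq_abs, sq_abs] at this
  linarith

theorem memLp_conv {κ : Vec d → ℝ} (hκ : IsKer (1 / 2) κ) {f : Torus d → ℝ} (hf : MemLp f 2) :
    MemLp (conv κ f) 2 := by
  have hs := sm_conv hκ (hf.integrable (by norm_num))
  obtain ⟨C, -, hC⟩ := exists_bound_of_continuous hs.continuous
  exact MemLp.of_bound hs.continuous.aestronglyMeasurable C (ae_of_all _ hC)

/-- A squeeze. With `g` the mollification and `N = ∫ f²`, the inequality `(g - f)² ≥ 0` gives `∫ g²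
≥ 2 ∫ g f - N`, where `∫ g f → N` by continuity of translations; the upper bound `∫ g² ≤ N` is
contractivity. -/
theorem tendsto_integral_conv_sq {ρ : Vec d → ℝ} {C : ℝ} (hρ : IsMollifier ρ C)
    {f : Torus d → ℝ} (hfm : Measurable f) (hf : MemLp f 2) :
    Tendsto (fun ε => ∫ x, conv (scaled ε ρ) f x * conv (scaled ε ρ) f x) (𝓝[>] 0)
      (𝓝 (∫ x, f x ^ 2)) := by
  set N := ∫ x, f x ^ 2 with hN
  have hsmall : ∀ᶠ ε in 𝓝[>] (0 : ℝ), ε ∈ Ioc (0 : ℝ) (1 / 2) := Ioc_mem_nhdsGT (by norm_num)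
  have hpos : ∀ {ε : ℝ}, 0 < ε → ∀ y, 0 ≤ scaled ε ρ y := fun hε y =>
    mul_nonneg (inv_nonneg.2 (pow_nonneg hε.le _)) (hρ.nonneg _)
  have hint1 : ∀ {ε : ℝ}, 0 < ε → ∫ y, scaled ε ρ y = 1 := fun hε => by
    rw [integral_scaled hε, hρ.integral_eq]
  have ha : Tendsto (fun ε => ∫ x, conv (scaled ε ρ) f x * f x) (𝓝[>] 0) (𝓝 N) := by
    rw [Metric.tendsto_nhds]
    intro η hη
    have h1 := (tendsto_integral_shift_mul hf).comp
      (by simpa [toTorus_zero] using (continuous_toTorus (d := d)).tendsto 0 :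
        Tendsto (toTorus : Vec d → Torus d) (𝓝 0) (𝓝 0))
    obtain ⟨δ, hδ, hδτ⟩ := Metric.tendsto_nhds_nhds.1 h1 (η / 2) (by positivity)
    filter_upwards [hsmall, Ioo_mem_nhdsGT hδ] with ε hε hεδ
    have k1 := isKer_scaled hε.1 hρ.isKer
    have kκ := k1.mono hε.2
    rw [integral_conv_mul kκ hfm hfm (integrable_shift_mul hf hf)
      (integral_norm_shift_mul_le hf hf), dist_eq_norm]
    have e : (∫ y, scaled ε ρ y * ∫ x, f (x - toTorus y) * f x) - N =
        ∫ y, scaled ε ρ y * ((∫ x, f (x - toTorus y) * f x) - N) := by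
      simp_rw [mul_sub]
      rw [integral_sub, integral_mul_const, hint1 hε.1, one_mul]
      · refine kκ.integrable.mul_bdd (c := (N + N) / 2) ?_ (ae_of_all _ fun y => ?_)
        · refine AEStronglyMeasurable.integral_prod_right'
            (f := fun p : Vec d × Torus d => f (p.2 - toTorus p.1) * f p.2) ?_
          have := measurable_toTorus (d := d)
          exact Measurable.aestronglyMeasurable (by fun_prop)
        · exact (norm_integral_le_integral_norm _).trans (integral_norm_shift_mul_le hf hf _)
      · exact kκ.integrable.mul_const N
    rw [e]
    refine lt_of_le_of_lt (norm_integral_le_of_norm_le (kκ.integrable.mul_const (η / 2))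
      (ae_of_all _ fun y => ?_)) ?_
    · rw [norm_mul, Real.norm_of_nonneg (hpos hε.1 y)]
      by_cases hy : y ∈ Metric.ball (0 : Vec d) ε
      · refine mul_le_mul_of_nonneg_left ?_ (hpos hε.1 y)
        exact (hδτ (lt_trans (Metric.mem_ball.1 hy) hεδ.2)).le
      · simp [k1.eq_zero hy]
    · rw [integral_mul_const, hint1 hε.1]
      linarith
  have hlow : Tendsto (fun ε => 2 * (∫ x, conv (scaled ε ρ) f x * f x) - N) (𝓝[>] 0) (𝓝 N) := by
    have := (ha.const_mul 2).sub_const N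
    rwa [show 2 * N - N = N by ring] at this
  refine tendsto_of_tendsto_of_tendsto_of_le_of_le' hlow tendsto_const_nhds ?_ ?_
  · filter_upwards [hsmall] with ε hε
    have kκ := (isKer_scaled hε.1 hρ.isKer).mono hε.2
    have hg := memLp_conv kκ hf
    have i1 : Integrable fun x => conv (scaled ε ρ) f x * f x := hg.integrable_mul hf
    have i2 : Integrable fun x => conv (scaled ε ρ) f x * conv (scaled ε ρ) f x :=
      hg.integrable_mul hg
    rw [hN, ← integral_const_mul, ← integral_sub (i1.const_mul 2) hf.integrable_sq]
    refine integral_mono ((i1.const_mul 2).sub hf.integrable_sq) i2 fun x => ?_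
    nlinarith [sq_nonneg (conv (scaled ε ρ) f x - f x)]
  · filter_upwards [hsmall] with ε hε
    have kκ := (isKer_scaled hε.1 hρ.isKer).mono hε.2
    have hg := memLp_conv kκ hf
    set g := conv (scaled ε ρ) f with hgdef
    have hgm : Measurable g := (sm_conv kκ (hf.integrable (by norm_num))).continuous.measurable
    have h1 := integral_conv_mul kκ hfm hgm (integrable_shift_mul hf hg)
      (integral_norm_shift_mul_le hf hg)
    -- Writing one factor `g` as an average of translates of `f` leaves half of `∫ g²` on the right,
    -- which is then absorbed.
    have h2 : ∫ x, g x * g x ≤ (N + ∫ x, g x ^ 2) / 2 := by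
      rw [h1]
      have hb := norm_integral_le_of_norm_le
        (f := fun y => scaled ε ρ y * ∫ x, f (x - toTorus y) * g x)
        (kκ.integrable.mul_const ((N + ∫ x, g x ^ 2) / 2)) (ae_of_all _ fun y => ?_)
      · refine (le_abs_self _).trans (hb.trans (le_of_eq ?_))
        rw [integral_mul_const, hint1 hε.1, one_mul]
      · rw [norm_mul, Real.norm_of_nonneg (hpos hε.1 y)]
        exact mul_le_mul_of_nonneg_left ((norm_integral_le_integral_norm _).trans
          (integral_norm_shift_mul_le hf hg _)) (hpos hε.1 y)
    have h3 : ∫ x, g x ^ 2 = ∫ x, g x * g x := by simp_rw [sq]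
    linarith

theorem tendsto_pairing {ρ : Vec d → ℝ} {C : ℝ} (hρ : IsMollifier ρ C) (v : L2 d m) :
    Tendsto (fun ε => pairing (scaled ε ρ) v v) (𝓝[>] 0)
      (𝓝 (∑ i : Fin 3, ∫ x, cf v i x ^ 2)) := by
  have h := tendsto_finsetSum (Finset.univ : Finset (Fin 3)) fun i _ =>
    tendsto_integral_conv_sq hρ (measurable_cf v i) (memLp_cf v i)
  refine h.congr' ?_
  filter_upwards [(Ioc_mem_nhdsGT (by norm_num : (0 : ℝ) < 1 / 2))] with ε hε
  rw [pairing_comm ((isKer_scaled hε.1 hρ.isKer).mono hε.2) (scaled_neg hρ.even)]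

/-! ### Semicontinuity of the averaged increments -/

/-- Fatou twice. Tonelli puts the shift outside, because almost everywhere convergence is
translation invariant for each fixed shift. -/
theorem lintegral_increments_le_liminf (μ : Measure (Vec d)) [SFinite μ]
    {f : ℕ → Torus d → Vec m} {g : Torus d → Vec m} (hf : ∀ k, Measurable (f k))
    (hg : Measurable g) (hfg : ∀ᵐ x, Tendsto (fun k => f k x) atTop (𝓝 (g x))) :
    ∫⁻ x, ∫⁻ y, ‖g x - g (x - toTorus y)‖ₑ ^ (3 : ℝ) ∂μ ≤
      liminf (fun k => ∫⁻ x, ∫⁻ y, ‖f k x - f k (x - toTorus y)‖ₑ ^ (3 : ℝ) ∂μ) atTop := by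
  have ht := measurable_toTorus (d := d)
  have hm : ∀ v : Torus d → Vec m, Measurable v → Measurable fun p : Torus d × Vec d =>
      ‖v p.1 - v (p.1 - toTorus p.2)‖ₑ ^ (3 : ℝ) := fun v hv => by fun_prop
  have hswap : ∀ v : Torus d → Vec m, Measurable v →
      ∫⁻ x, ∫⁻ y, ‖v x - v (x - toTorus y)‖ₑ ^ (3 : ℝ) ∂μ =
      ∫⁻ y, ∫⁻ x, ‖v x - v (x - toTorus y)‖ₑ ^ (3 : ℝ) ∂volume ∂μ := fun v hv =>
    lintegral_lintegral_swap (hm v hv).aemeasurable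
  have h1 : ∀ y, ∫⁻ x, ‖g x - g (x - toTorus y)‖ₑ ^ (3 : ℝ) ≤
      liminf (fun k => ∫⁻ x, ‖f k x - f k (x - toTorus y)‖ₑ ^ (3 : ℝ)) atTop := by
    intro y
    have hmy : ∀ k, Measurable fun x => ‖f k x - f k (x - toTorus y)‖ₑ ^ (3 : ℝ) := fun k => by
      have := hf k
      fun_prop
    refine le_trans (lintegral_mono_ae ?_) (lintegral_liminf_le hmy)
    have h2 := (measurePreserving_sub_right (volume : Measure (Torus d))
      (toTorus y)).quasiMeasurePreserving.ae hfg
    filter_upwards [hfg, h2] with x e1 e2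
    refine le_of_eq (Tendsto.liminf_eq ?_).symm
    exact ((ENNReal.continuous_rpow_const.tendsto _).comp
      ((continuous_enorm.tendsto _).comp (e1.sub e2)))
  have h3 : ∀ k, Measurable fun y => ∫⁻ x, ‖f k x - f k (x - toTorus y)‖ₑ ^ (3 : ℝ) := fun k =>
    (hm _ (hf k)).lintegral_prod_left'
  rw [hswap g hg]
  simp_rw [fun k => hswap (f k) (hf k)]
  exact (lintegral_mono h1).trans (lintegral_liminf_le h3)

/-- The increments may be infinite on `L²`, so continuity is out of reach; Fatou along an almost
everywhere convergent subsequence shows that sublevel sets are closed. This suffices for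
measurability along a continuous path, which is used to split the time integrals. -/
theorem lowerSemicontinuous_incr (ε : ℝ) : LowerSemicontinuous (incr ε : L2 d m → ENNReal) := by
  rw [lowerSemicontinuous_iff_isClosed_preimage]
  intro c
  refine IsSeqClosed.isClosed fun v w hv hvw => ?_
  obtain ⟨ns, -, hae⟩ := (tendstoInMeasure_of_tendsto_Lp hvw).exists_seq_tendsto_ae
  have h1 := lintegral_increments_le_liminf (((volume.restrict (Metric.ball (0 : Vec d) ε)) univ)⁻¹ •
    volume.restrict (Metric.ball (0 : Vec d) ε)) (fun k => measurable_L2 (v (ns k)))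
    (measurable_L2 w) hae
  have h2 : incr ε w ≤ liminf (fun k => incr ε (v (ns k))) atTop := h1
  refine h2.trans (liminf_le_of_le (by isBoundedDefault) fun b hb => ?_)
  obtain ⟨k, hk⟩ := hb.exists
  exact hk.trans (hv (ns k))

theorem measurable_incr {v : ℝ → L2 d m} (hv : Continuous v) (ε : ℝ) :
    Measurable fun t => incr ε (v t) :=
  LowerSemicontinuous.measurable
    (LowerSemicontinuous.comp (f := incr ε) (g := v) (lowerSemicontinuous_incr ε) hv)

/-- With both exponents equal to 3 the inner power is 1, and cubing the seminorm turns `ε^{-α}` into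
`ε^{-3α}`. -/
theorem MemBesovVMO.tendsto_incr {T α : ℝ} {v : ℝ → L2 d m} (h : MemBesovVMO T 3 3 α v) :
    Tendsto (fun ε : ℝ => ENNReal.ofReal (ε ^ (-α * 3)) * ∫⁻ t in Ioo 0 T, incr ε (v t))
      (𝓝[>] 0) (𝓝 0) := by
  have h1 := (ENNReal.continuous_rpow_const (y := 3)).tendsto 0 |>.comp h.vmo
  rw [ENNReal.zero_rpow_of_pos (by norm_num)] at h1
  refine h1.congr' ?_
  filter_upwards [self_mem_nhdsWithin] with ε hε
  have hε : 0 < ε := hε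
  simp only [Function.comp_apply]
  rw [ENNReal.mul_rpow_of_nonneg _ _ (by norm_num), ← ENNReal.rpow_mul,
    ENNReal.ofReal_rpow_of_nonneg (Real.rpow_nonneg hε.le _) (by norm_num), ← Real.rpow_mul hε.le]
  norm_num [incr]

/-! ### Energy conservation -/

/-- Since `m ≤ 3`, passing to three components loses nothing. -/
theorem norm_sq_eq_sum_comp (hm : m = 2 ∨ m = 3) (v : Vec m) :
    ‖v‖ ^ 2 = ∑ i : Fin 3, comp v i ^ 2 := by
  rw [EuclideanSpace.real_norm_sq_eq]
  rcases hm with rfl | rfl <;> simp [Fin.sum_univ_succ, comp]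

theorem integral_norm_sq_eq (hm : m = 2 ∨ m = 3) (v : L2 d m) :
    ∫ x, ‖v x‖ ^ 2 = ∑ i : Fin 3, ∫ x, cf v i x ^ 2 := by
  rw [← integral_finsetSum _ fun i _ => (memLp_cf v i).integrable_sq]
  simp_rw [norm_sq_eq_sum_comp hm]
  rfl

theorem energy_eq (hm : m = 2 ∨ m = 3) (u h : L2 d m) :
    energy u h = (1 / 2) *
      ((∑ i : Fin 3, ∫ x, cf u i x ^ 2) + ∑ i : Fin 3, ∫ x, cf h i x ^ 2) := by
  have hi : ∀ v : L2 d m, Integrable fun x => ‖v x‖ ^ 2 := fun v => (Lp.memLp v).norm.integrable_sq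
  rw [energy, integral_add (hi u) (hi h), integral_norm_sq_eq hm, integral_norm_sq_eq hm]

theorem energy_eq_of_continuous (hm : m = 2 ∨ m = 3) {T : ℝ} (hT : 0 < T) {u h : ℝ → L2 d m}
    (hu : Continuous u) (hh : Continuous h) (hsol : IsWeakSolution T u h)
    (hu_vmo : Tendsto (fun ε : ℝ => ENNReal.ofReal (ε ^ (-(1 / 3 : ℝ) * 3)) *
      ∫⁻ t in Ioo 0 T, incr ε (u t)) (𝓝[>] 0) (𝓝 0))
    (hh_vmo : Tendsto (fun ε : ℝ => ENNReal.ofReal (ε ^ (-(2 / 3 : ℝ) * 3)) *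
      ∫⁻ t in Ioo 0 T, incr ε (h t)) (𝓝[>] 0) (𝓝 0)) {t : ℝ} (ht : t ∈ Icc 0 T) :
    energy (u t) (h t) = energy (u 0) (h 0) := by
  obtain ⟨ρ, C, hρ⟩ := exists_isMollifier d
  obtain ⟨A, hA⟩ : ∃ A, A = avgConst d C * (avgConst d C + avgConst d C * avgConst d C) := ⟨_, rfl⟩
  have hA' : A ≠ ⊤ := by
    have := avgConst_ne_top (d := d) C
    rw [hA]; finiteness
  set IU : ℝ → ENNReal := fun ε => ∫⁻ t in Ioo 0 T, incr ε (u t) with hIU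
  set IH : ℝ → ENNReal := fun ε => ∫⁻ t in Ioo 0 T, incr ε (h t) with hIH
  set E : ℝ → ℝ → ℝ := fun ε t =>
    pairing (scaled ε ρ) (u t) (u t) + pairing (scaled ε ρ) (h t) (h t) with hE
  have hlim : ∀ t, Tendsto (fun ε => E ε t) (𝓝[>] 0)
      (𝓝 ((∑ i : Fin 3, ∫ x, cf (u t) i x ^ 2) + ∑ i : Fin 3, ∫ x, cf (h t) i x ^ 2)) := fun t =>
    (tendsto_pairing hρ (u t)).add (tendsto_pairing hρ (h t))
  have hbound : ∀ᶠ ε in 𝓝[>] (0 : ℝ), ‖E ε t - E ε 0‖ₑ ≤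
      2 * A * (144 * (ENNReal.ofReal (ε ^ (-(1 / 3 : ℝ) * 3)) * IU ε
        + ENNReal.ofReal (ε ^ (-(2 / 3 : ℝ) * 3)) * IH ε)
        + 18 * (ENNReal.ofReal (ε ^ (-(2 / 3 : ℝ) * 3)) * IH ε)) := by
    filter_upwards [(Ioc_mem_nhdsGT (by norm_num : (0 : ℝ) < 1 / 2))] with ε hε
    have kκ := (isKer_scaled hε.1 hρ.isKer).mono hε.2
    have p1 : ε ^ (-(1 / 3 : ℝ) * 3) = ε⁻¹ := by
      rw [show (-(1 / 3 : ℝ) * 3) = -1 by norm_num, Real.rpow_neg_one]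
    have p2 : ε ^ (-(2 / 3 : ℝ) * 3) = ε⁻¹ * ε⁻¹ := by
      rw [show (-(2 / 3 : ℝ) * 3) = -1 + -1 by norm_num, Real.rpow_add hε.1, Real.rpow_neg_one]
    have q1 : ‖ε⁻¹‖ₑ = ENNReal.ofReal ε⁻¹ := Real.enorm_of_nonneg (inv_nonneg.2 hε.1.le)
    have q2 : ‖ε⁻¹ * ε⁻¹‖ₑ = ENNReal.ofReal (ε⁻¹ * ε⁻¹) := Real.enorm_of_nonneg (by
      have := hε.1; positivity)
    -- For `ε ≤ 1` the weight `ε⁻¹` is at most `ε⁻²`, so the increments of `h` in the convective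
    -- terms are covered by the stronger condition on `h`.
    have q3 : ENNReal.ofReal ε⁻¹ ≤ ENNReal.ofReal (ε⁻¹ * ε⁻¹) := by
      refine ENNReal.ofReal_le_ofReal (le_mul_of_one_le_left (inv_nonneg.2 hε.1.le) ?_)
      exact (one_le_inv₀ hε.1).2 (by linarith [hε.2])
    rw [p1, p2]
    obtain ⟨a, ha⟩ : ∃ a, a = ENNReal.ofReal ε⁻¹ := ⟨_, rfl⟩
    obtain ⟨b, hb⟩ : ∃ b, b = ENNReal.ofReal (ε⁻¹ * ε⁻¹) := ⟨_, rfl⟩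
    rw [← ha, ← hb] at q3 ⊢
    have mU := measurable_incr hu ε
    have mH := measurable_incr hh ε
    have hflux : ∀ r ∈ Ioc 0 t, ‖flux (scaled ε ρ) (cf (u r)) (cf (h r))‖ₑ ≤
        A * (144 * (a * (incr ε (u r) + incr ε (h r))) + 18 * (b * incr ε (h r))) := by
      intro r hr
      have hr' : r ∈ Icc 0 T := ⟨hr.1.le, hr.2.trans ht.2⟩
      have := enorm_flux_le hρ hε.1 hε.2 (hsol.divFree_u.wDivFree hT hu hr')
        (hsol.divFree_h.wDivFree hT hh hr')
      rwa [q1, q2, ← hA, ← ha, ← hb] at this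
    have hE' : E ε t - E ε 0 = 2 * ∫ r in (0 : ℝ)..t, flux (scaled ε ρ) (cf (u r)) (cf (h r)) :=
      hsol.mollified_energy_sub hT hu hh kκ (scaled_neg hρ.even) ht
    have ha' : a ≠ ⊤ := by rw [ha]; exact ENNReal.ofReal_ne_top
    have hb' : b ≠ ⊤ := by rw [hb]; exact ENNReal.ofReal_ne_top
    rw [hE', enorm_mul, intervalIntegral.integral_of_le ht.1, mul_assoc]
    refine mul_le_mul' (by simp [Real.enorm_eq_ofReal_abs]) ?_
    calc ‖∫ r in Ioc 0 t, flux (scaled ε ρ) (cf (u r)) (cf (h r))‖ₑ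
        ≤ ∫⁻ r in Ioc 0 t, ‖flux (scaled ε ρ) (cf (u r)) (cf (h r))‖ₑ :=
          enorm_integral_le_lintegral_enorm _
      _ ≤ ∫⁻ r in Ioc 0 t,
            A * (144 * (a * (incr ε (u r) + incr ε (h r))) + 18 * (b * incr ε (h r))) :=
          setLIntegral_mono' measurableSet_Ioc hflux
      _ ≤ ∫⁻ r in Ioc 0 T,
            A * (144 * (a * (incr ε (u r) + incr ε (h r))) + 18 * (b * incr ε (h r))) :=
          lintegral_mono_set (Ioc_subset_Ioc_right ht.2)
      _ = ∫⁻ r in Ioo 0 T,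
            A * (144 * (a * (incr ε (u r) + incr ε (h r))) + 18 * (b * incr ε (h r))) :=
          setLIntegral_congr Ioo_ae_eq_Ioc.symm
      _ = A * (144 * (a * (IU ε + IH ε)) + 18 * (b * IH ε)) := by
          rw [lintegral_const_mul' _ _ hA', lintegral_add_right _ ((mH.const_mul _).const_mul _),
            lintegral_const_mul' _ _ ENNReal.ofNat_ne_top, lintegral_const_mul' _ _ ha',
            lintegral_const_mul' _ _ ENNReal.ofNat_ne_top, lintegral_const_mul' _ _ hb',
            lintegral_add_right _ mH]
      _ ≤ A * (144 * (a * IU ε + b * IH ε) + 18 * (b * IH ε)) := by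
          rw [mul_add a]
          gcongr
  have hzero : Tendsto (fun ε : ℝ =>
      2 * A * (144 * (ENNReal.ofReal (ε ^ (-(1 / 3 : ℝ) * 3)) * IU ε
        + ENNReal.ofReal (ε ^ (-(2 / 3 : ℝ) * 3)) * IH ε)
        + 18 * (ENNReal.ofReal (ε ^ (-(2 / 3 : ℝ) * 3)) * IH ε))) (𝓝[>] 0) (𝓝 0) := by
    have h1 := ENNReal.Tendsto.const_mul (a := 144) (hu_vmo.add hh_vmo)
      (Or.inr ENNReal.ofNat_ne_top)
    have h2 := ENNReal.Tendsto.const_mul (a := 18) hh_vmo (Or.inr ENNReal.ofNat_ne_top)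
    have h3 := ENNReal.Tendsto.const_mul (a := 2 * A) (h1.add h2)
      (Or.inr (ENNReal.mul_ne_top ENNReal.ofNat_ne_top hA'))
    simpa using h3
  -- The mollified energy difference has two limits, the true difference and zero.
  have hdiff := ((hlim t).sub (hlim 0)).enorm
  have h0 := tendsto_of_tendsto_of_tendsto_of_le_of_le' tendsto_const_nhds hzero
    (Eventually.of_forall fun ε => bot_le) hbound
  have heq := tendsto_nhds_unique hdiff h0
  rw [enorm_eq_zero, sub_eq_zero] at heq
  rw [energy_eq hm, energy_eq hm, heq]

/-! ### Reduction to fields continuous on the whole line -/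

theorem IsWeakSolution.congr {T : ℝ} (hT : 0 < T) {u h u' h' : ℝ → L2 d m}
    (hsol : IsWeakSolution T u h) (hu : ∀ t ∈ Icc 0 T, u' t = u t)
    (hh : ∀ t ∈ Icc 0 T, h' t = h t) : IsWeakSolution T u' h' where
  weaklyContinuous_u w := (hsol.weaklyContinuous_u w).congr fun t ht => by simp only [hu t ht]
  weaklyContinuous_h w := (hsol.weaklyContinuous_h w).congr fun t ht => by simp only [hh t ht]
  divFree_u ψ hψ := by
    refine Eq.trans ?_ (hsol.divFree_u ψ hψ)
    apply intervalIntegral.integral_congr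
    intro t ht
    rw [uIcc_of_le hT.le] at ht
    simp only [hu t ht]
  divFree_h ψ hψ := by
    refine Eq.trans ?_ (hsol.divFree_h ψ hψ)
    apply intervalIntegral.integral_congr
    intro t ht
    rw [uIcc_of_le hT.le] at ht
    simp only [hh t ht]
  momentum φ hφ := by
    refine Eq.trans ?_ (hsol.momentum φ hφ)
    apply intervalIntegral.integral_congr
    intro t ht
    rw [uIcc_of_le hT.le] at ht
    simp only [hu t ht, hh t ht]
  induction φ hφ := by
    refine Eq.trans ?_ (hsol.induction φ hφ)
    apply intervalIntegral.integral_congr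
    intro t ht
    rw [uIcc_of_le hT.le] at ht
    simp only [hu t ht, hh t ht]

end HallMHD

end

theorem theorem1p3 (d m : ℕ) (hd : d = 2 ∨ d = 3) (hm : m = d ∨ m = 3)
    (T : ℝ) (hT : 0 < T) (u h : ℝ → HallMHD.L2 d m)
    (hu : ContinuousOn u (Set.Icc 0 T)) (hh : ContinuousOn h (Set.Icc 0 T))
    (hsol : HallMHD.IsWeakSolution T u h)
    (hu_vmo : HallMHD.MemBesovVMO T 3 3 (1 / 3) u)
    (hh_vmo : HallMHD.MemBesovVMO T 3 3 (2 / 3) h) :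
    ∀ t ∈ Set.Icc 0 T, HallMHD.energy (u t) (h t) = HallMHD.energy (u 0) (h 0) := by
  intro t ht
  have hm' : m = 2 ∨ m = 3 := by omega
  have h0 : (0 : ℝ) ∈ Icc 0 T := ⟨le_rfl, hT.le⟩
  -- Extending the fields by their endpoint values makes them continuous on all of `ℝ`, and nothing
  -- in the hypotheses or the conclusion sees times outside `[0, T]`.
  have hc : ∀ {v : ℝ → HallMHD.L2 d m}, ContinuousOn v (Icc 0 T) →
      Continuous (IccExtend hT.le ((Icc 0 T).domRestrict v)) := fun hv =>
    (continuousOn_iff_continuous_domRestrict.1 hv).Icc_extend'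
  have he : ∀ (v : ℝ → HallMHD.L2 d m), ∀ t ∈ Icc 0 T,
      IccExtend hT.le ((Icc 0 T).domRestrict v) t = v t := fun v t ht => by
    rw [IccExtend_of_mem _ _ ht]; rfl
  have hv : ∀ (v : ℝ → HallMHD.L2 d m) (ε : ℝ),
      ∫⁻ t in Ioo 0 T, HallMHD.incr ε (IccExtend hT.le ((Icc 0 T).domRestrict v) t) =
        ∫⁻ t in Ioo 0 T, HallMHD.incr ε (v t) := fun v ε =>
    setLIntegral_congr_fun measurableSet_Ioo fun t ht => by
      simp only [he v t (Ioo_subset_Icc_self ht)]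
  have := HallMHD.energy_eq_of_continuous hm' hT (hc hu) (hc hh) (hsol.congr hT (he u) (he h))
    (by simpa only [hv] using hu_vmo.tendsto_incr) (by simpa only [hv] using hh_vmo.tendsto_incr) ht
  rwa [he u t ht, he h t ht, he u 0 h0, he h 0 h0] at this
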